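/- For every $d\in\mathbb N$, $d\ge 1$, and all $R>0$, $M>0$ there is a constant $C>0$, depending only on $d,R,M$, such that the following holds. Let $\mu,\nu$ be probability measures on $\mathbb R^d$ whose supports are contained in the open ball $B_R=\{x:\|x\|<R\}$, and suppose that $\mu$ has a density with respect to Lebesgue measure that is bounded above by $M$. Let $\Gamma_0(\mathbb R^d)$ be the set of proper lower semicontinuous convex functions $\varphi:\mathbb R^d\to\mathbb R\cup\{+\infty\}$, let $\varphi^*(y)=\sup_{x}\langle x,y\rangle-\varphi(x)$, and let $\bar\varphi$ be any Brenier potential for $(\mu,\nu)$, i.e. a minimizer of $\varphi\mapsto\int\varphi\,d\mu+\int\varphi^*\,d\nu$ over $\Gamma_0(\mathbb R^d)$. Let $n,m\ge 1$, let $X_1,\dots,X_n$ be i.i.d. with law $\mu$ and $Y_1,\dots,Y_m$ i.i.d. with law $\nu$, with empirical measures $\hat\mu_n=\frac1n\sum_i\delta_{X_i}$ and $\hat\nu_m=\frac1m\sum_j\delta_{Y_j}$. Let $(f,g)\in\mathbb R^n\times\mathbb R^m$ (depending on the samples) be any optimal solution of the dual transport linear program $$\max\Big\{\tfrac1n\sum_{i=1}^n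 f_i+\tfrac1m\sum_{j=1}^m g_j \;:\; f_i+g_j\le\tfrac12\|X_i-Y_j\|^2\ \text{ for all } i,j\Big\}.$$ Put $\varphi_g(x)=\max_{k=1,\dots,m}\langle x,Y_k\rangle+g_k-\tfrac12\|Y_k\|^2$, let $I(x)=\{j:\varphi_g(x)=\langle x,Y_j\rangle+g_j-\tfrac12\|Y_j\|^2\}$ be the set of active indices, and define the estimator $$\hat T_{n,m}(x)=\frac{1}{|I(x)|}\sum_{j\in I(x)}Y_j ,\qquad x\in\mathbb R^d.$$ Then $$\mathbb E\left[\int_{\mathbb R^d}\|\nabla\bar\varphi(x)-\hat T_{n,m}(x)\|\,d\mu(x)\right]\le C\begin{cases}\left(n^{-1/2}+m^{-1/2}\right)^{1/4}&\text{if } d=1,\\ \left(n^{-1/2}\log(1+n)+m^{-1/2}\log(1+m)\right)^{1/4}&\text{if } d=2,\\ \left(n^{-1/d}+m^{-1/d}\right)^{1/4}&\text{if } d>2.\end{cases}$$ -/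

import Mathlib

open MeasureTheory ProbabilityTheory

noncomputable section

namespace BrenierEstimation

/-- `ℝ^d` with the Euclidean norm. -/
abbrev E (d : ℕ) : Type := EuclideanSpace ℝ (Fin d)

/-- The class `Γ₀(ℝ^d)` of proper, lower semicontinuous, convex functions with values in
`ℝ ∪ {+∞}`. Convexity is convexity of the epigraph. -/
structure IsGammaZero {d : ℕ} (φ : E d → EReal) : Prop where
  convex_epigraph : Convex ℝ {p : E d × ℝ | φ p.1 ≤ (p.2 : EReal)}
  lowerSemicontinuous : LowerSemicontinuous φ
  ne_bot : ∀ x, φ x ≠ ⊥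
  proper : ∃ x, φ x ≠ ⊤

/-- The Fenchel-Legendre transform `φ^*(y) = sup_x ⟨x, y⟩ - φ(x)`. -/
def conjugate {d : ℕ} (φ : E d → EReal) (y : E d) : EReal :=
  ⨆ x : E d, ((inner ℝ x y : ℝ) : EReal) - φ x

/-- The integral of an extended-real-valued function, as the integral of its positive part minus
the integral of its negative part. For a function in `Γ₀` and a finite measure of bounded support,
the negative part has finite integral (the function has an affine minorant), so this is the usual
integral with values in `ℝ ∪ {+∞}`. -/
def extIntegral {d : ℕ} (φ : E d → EReal) (μ : Measure (E d)) : EReal :=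
  ((∫⁻ x, (φ x).toENNReal ∂μ : ENNReal) : EReal) - ((∫⁻ x, (-φ x).toENNReal ∂μ : ENNReal) : EReal)

/-- The dual functional `∫ φ dμ + ∫ φ^* dν`. -/
def dualObjective {d : ℕ} (μ ν : Measure (E d)) (φ : E d → EReal) : EReal :=
  extIntegral φ μ + extIntegral (conjugate φ) ν

/-- `φ` is a Brenier potential for `(μ, ν)`: it is an optimal solution of the dual problem
`inf_{φ ∈ Γ₀} ∫ φ dμ + ∫ φ^* dν`. -/
structure IsBrenierPotential {d : ℕ} (μ ν : Measure (E d)) (φ : E d → EReal) : Prop where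
  gammaZero : IsGammaZero φ
  optimal : ∀ ψ : E d → EReal, IsGammaZero ψ → dualObjective μ ν φ ≤ dualObjective μ ν ψ

/-- The gradient of an extended-real-valued function, meant at interior points of its domain
where it is differentiable. -/
def extGradient {d : ℕ} (φ : E d → EReal) (x : E d) : E d :=
  gradient (fun z => (φ z).toReal) x

/-- `μ` has a density with respect to Lebesgue measure, and this density is at most `M`. -/
def HasDensityAtMost {d : ℕ} (μ : Measure (E d)) (M : ℝ) : Prop :=
  ∃ ρ : E d → ENNReal, Measurable ρ ∧ μ = (volume : Measure (E d)).withDensity ρ ∧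
    ∀ᵐ x ∂(volume : Measure (E d)), ρ x ≤ ENNReal.ofReal M

/-- Feasible points `(f, g)` of the dual linear program of the optimal transport problem with cost
`C i j = ‖x i - y j‖² / 2`. -/
def IsDualFeasible {d n m : ℕ} (x : Fin n → E d) (y : Fin m → E d)
    (f : Fin n → ℝ) (g : Fin m → ℝ) : Prop :=
  ∀ i j, f i + g j ≤ ‖x i - y j‖ ^ 2 / 2

/-- `(f, g)` is an optimal solution of the dual linear program
`max ⟨f, a⟩ + ⟨g, b⟩` subject to `f i + g j ≤ ‖x i - y j‖² / 2`,
for the discrete measures `∑ i, a i • δ_{x i}` and `∑ j, b j • δ_{y j}`. -/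
structure IsDualOptimal {d n m : ℕ} (a : Fin n → ℝ) (x : Fin n → E d)
    (b : Fin m → ℝ) (y : Fin m → E d) (f : Fin n → ℝ) (g : Fin m → ℝ) : Prop where
  feasible : IsDualFeasible x y f g
  optimal : ∀ f' g', IsDualFeasible x y f' g' →
    ∑ i, f' i * a i + ∑ j, g' j * b j ≤ ∑ i, f i * a i + ∑ j, g j * b j

/-- `(f, g)` is an optimal solution of the dual linear program for the empirical measures
`n⁻¹ ∑ i, δ_{x i}` and `m⁻¹ ∑ j, δ_{y j}`. -/
def IsEmpiricalDualOptimal {d n m : ℕ} (x : Fin n → E d) (y : Fin m → E d)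
    (f : Fin n → ℝ) (g : Fin m → ℝ) : Prop :=
  IsDualOptimal (fun _ => (n : ℝ)⁻¹) x (fun _ => (m : ℝ)⁻¹) y f g

/-- The affine function `x ↦ ⟨x, y_k⟩ + g_k - ‖y_k‖² / 2`. -/
def affinePiece {d m : ℕ} (y : Fin m → E d) (g : Fin m → ℝ) (k : Fin m) (x : E d) : ℝ :=
  inner ℝ x (y k) + g k - ‖y k‖ ^ 2 / 2

/-- The explicit potential `φ_g(x) = max_k ⟨x, y_k⟩ + g_k - ‖y_k‖² / 2` (used for `m ≥ 1`). -/
def explicitPotential {d m : ℕ} (y : Fin m → E d) (g : Fin m → ℝ) (x : E d) : ℝ :=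
  ⨆ k : Fin m, affinePiece y g k x

open Classical in
/-- The set `I(x)` of active indices of `φ_g` at `x`. -/
def activeSet {d m : ℕ} (y : Fin m → E d) (g : Fin m → ℝ) (x : E d) : Finset (Fin m) :=
  Finset.univ.filter fun j => explicitPotential y g x = affinePiece y g j x

/-- The Monge map estimator: the average of the `y_j` over the active indices `j ∈ I(x)`. -/
def mongeEstimator {d m : ℕ} (y : Fin m → E d) (g : Fin m → ℝ) (x : E d) : E d :=
  ((activeSet y g x).card : ℝ)⁻¹ • ∑ j ∈ activeSet y g x, y j

/-- The convergence rate in dimension `d`. -/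
def rate (d n m : ℕ) : ℝ :=
  if d = 1 then
    ((n : ℝ) ^ (-(1 / 2) : ℝ) + (m : ℝ) ^ (-(1 / 2) : ℝ)) ^ (1 / 4 : ℝ)
  else if d = 2 then
    ((n : ℝ) ^ (-(1 / 2) : ℝ) * Real.log (1 + n)
      + (m : ℝ) ^ (-(1 / 2) : ℝ) * Real.log (1 + m)) ^ (1 / 4 : ℝ)
  else
    ((n : ℝ) ^ (-(1 / (d : ℝ))) + (m : ℝ) ^ (-(1 / (d : ℝ)))) ^ (1 / 4 : ℝ)

end BrenierEstimation

end

/-!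
A Brenier potential has the same gradient, `μ`-almost everywhere, as the Legendre transform `u` over
the ball of radius `R` of a Lipschitz minimizer `a` of the semi-dual functional. The estimator
selects subgradients of a convex Lipschitz function `v = φ_g`, and by optimality of `(f, g)` the
pair `(v, v^*)` nearly attains the minimum: the loss `δ` is at most a multiple of the distances
between `μ`, `ν` and their empirical measures, tested on Lipschitz functions.

Let `s` be the transform of `(a + v^*) / 2`. Since `2 s` is dominated by the infimal convolutions
`u (x + k) + v (x - k)`, comparing them with the subgradient inequalities bounds `|⟨p - q, k⟩|`, for
subgradients `p` of `u` and `q` of `v` at `x`, by `u x + v x - 2 s x` plus second differences of `u`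
and `v` in the direction `k`. Minimality of `a` bounds the mean of the first term by `δ`, and after
bounding `μ` by Lebesgue measure, summation by parts bounds that of the second differences by a
multiple of `‖k‖ ^ 2`. Balancing with `‖k‖` of order `√δ` gives a mean error of order `√δ`.

For the empirical measures, a quantizer of the ball with cells of radius `ε` reduces the distance to
the fluctuation of `O(ε ^ (-d))` cell masses, each estimated from its variance. The best choice
`ε = R * n ^ (-1 / (d + 2))` makes `δ` of order `n ^ (-1 / (d + 2)) + m ^ (-1 / (d + 2))`. Half of
the exponent `1 / (d + 2)` is at least the exponent of `rate` in every dimension.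
-/

noncomputable section

namespace BrenierEstimation

open Metric Set
open scoped NNReal RealInnerProductSpace

section AffineSup

variable {F ι : Type*} [NormedAddCommGroup F] [InnerProductSpace ℝ F]

/-- The convex function `sup_i ⟨p i, x⟩ - b i`. It covers both Legendre transforms and potentials of
discrete measures; the real supremum is meaningful when `p` is bounded and `b` is bounded below. -/
def affineSup (p : ι → F) (b : ι → ℝ) (x : F) : ℝ :=
  ⨆ i, (⟪p i, x⟫ - b i)

/-- `p` is a subgradient at `x` of the function `w`, in the global sense of convex analysis. -/
def IsSubgradientAt (w : F → ℝ) (p x : F) : Prop :=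
  ∀ z, w x + ⟪p, z - x⟫ ≤ w z

variable {p : ι → F} {b : ι → ℝ} {r : ℝ≥0}

lemma affineSup_le [Nonempty ι] {x : F} {c : ℝ} (h : ∀ i, ⟪p i, x⟫ - b i ≤ c) :
    affineSup p b x ≤ c :=
  ciSup_le h

lemma le_affineSup (hp : ∀ i, ‖p i‖ ≤ r) (hb : BddBelow (range b)) (i : ι) (x : F) :
    ⟪p i, x⟫ - b i ≤ affineSup p b x := by
  obtain ⟨c, hc⟩ := hb
  refine le_ciSup (f := fun i => ⟪p i, x⟫ - b i) ⟨r * ‖x‖ - c, ?_⟩ i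
  rintro _ ⟨j, rfl⟩
  have hinner : ⟪p j, x⟫ ≤ r * ‖x‖ := (real_inner_le_norm _ _).trans (by gcongr; exact hp j)
  exact sub_le_sub hinner (hc (mem_range_self j))

lemma lipschitzWith_affineSup [Nonempty ι] (hp : ∀ i, ‖p i‖ ≤ r) (hb : BddBelow (range b)) :
    LipschitzWith r (affineSup p b) := by
  refine LipschitzWith.of_le_add_mul _ fun x z => affineSup_le fun i => ?_
  have hinner : ⟪p i, x - z⟫ ≤ r * ‖x - z‖ := (real_inner_le_norm _ _).trans (by gcongr; exact hp i)
  have hz := le_affineSup hp hb i z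
  rw [inner_sub_right] at hinner
  rw [dist_eq_norm]
  linarith

lemma convexOn_affineSup [Nonempty ι] (hp : ∀ i, ‖p i‖ ≤ r) (hb : BddBelow (range b)) :
    ConvexOn ℝ univ (affineSup p b) := by
  refine ⟨convex_univ, fun x _ z _ α β hα hβ hαβ => affineSup_le fun i => ?_⟩
  calc ⟪p i, α • x + β • z⟫ - b i = α * (⟪p i, x⟫ - b i) + β * (⟪p i, z⟫ - b i) := by
        rw [inner_add_right, inner_smul_right, inner_smul_right]
        linear_combination b i * hαβ
    _ ≤ α * affineSup p b x + β * affineSup p b z := by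
        gcongr <;> exact le_affineSup hp hb i _

lemma isSubgradientAt_affineSup (hp : ∀ i, ‖p i‖ ≤ r) (hb : BddBelow (range b)) {i : ι} {x : F}
    (hi : affineSup p b x = ⟪p i, x⟫ - b i) : IsSubgradientAt (affineSup p b) (p i) x := by
  intro z
  have hz := le_affineSup hp hb i z
  rw [hi, inner_sub_right]
  linarith

lemma IsSubgradientAt.average {w : F → ℝ} {s : Finset ι} (hs : s.Nonempty) {x : F}
    (h : ∀ i ∈ s, IsSubgradientAt w (p i) x) :
    IsSubgradientAt w ((s.card : ℝ)⁻¹ • ∑ i ∈ s, p i) x := by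
  intro z
  have hcard : (0 : ℝ) < s.card := by exact_mod_cast hs.card_pos
  have hsum : ∑ i ∈ s, ⟪p i, z - x⟫ ≤ s.card * (w z - w x) := by
    rw [← nsmul_eq_mul]
    exact Finset.sum_le_card_nsmul _ _ _ fun i hi => le_sub_iff_add_le'.2 (h i hi z)
  rw [real_inner_smul_left, sum_inner, ← le_sub_iff_add_le']
  exact (inv_mul_le_iff₀ hcard).2 hsum

/-- The lower bound only has to hold near `x`: a differentiable function that touches `w` from above
at `x` has every subgradient of `w` there as its gradient. -/
lemma IsSubgradientAt.gradient_eq [CompleteSpace F] {w f : F → ℝ} {p x : F}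
    (h : IsSubgradientAt w p x) (hle : ∀ᶠ z in nhds x, w z ≤ f z) (heq : f x = w x)
    (hf : DifferentiableAt ℝ f x) : gradient f x = p := by
  have hmin : IsLocalMin (fun z => f z - ⟪p, z⟫) x := by
    filter_upwards [hle] with z hz
    have hsub := h z
    rw [inner_sub_right] at hsub
    linarith
  have hzero := hmin.hasFDerivAt_eq_zero (hf.hasFDerivAt.sub (innerSL ℝ p).hasFDerivAt)
  rw [gradient, sub_eq_zero.1 hzero]
  exact (InnerProductSpace.toDual ℝ F).symm_apply_apply p

end AffineSup

section ConjugateOn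

variable {F : Type*} [NormedAddCommGroup F] {S : Set F} {h : F → ℝ} {r : ℝ≥0}

lemma norm_coe_le_of_subset_closedBall (hS : S ⊆ closedBall 0 r) (x : S) : ‖(x : F)‖ ≤ r :=
  mem_closedBall_zero_iff.1 (hS x.2)

lemma bddBelow_image_closedBall [ProperSpace F] (hh : Continuous h) (x : F) (c : ℝ) :
    BddBelow (h '' closedBall x c) :=
  (isCompact_closedBall x c).bddBelow_image hh.continuousOn

variable [InnerProductSpace ℝ F]

/-- The Legendre transform `sup_{x ∈ S} ⟨x, y⟩ - h x` with the supremum restricted to `S`, so that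
it is finite for bounded `S`. -/
def conjugateOn (S : Set F) (h : F → ℝ) : F → ℝ :=
  affineSup (fun x : S => (x : F)) (fun x : S => h x)

lemma conjugateOn_le (hne : S.Nonempty) {y : F} {c : ℝ} (hc : ∀ x ∈ S, ⟪x, y⟫ - h x ≤ c) :
    conjugateOn S h y ≤ c :=
  have := hne.to_subtype
  affineSup_le fun x => hc x x.2

lemma inner_sub_le_conjugateOn (hS : S ⊆ closedBall 0 r) (hb : BddBelow (h '' S)) {x : F}
    (hx : x ∈ S) (y : F) : ⟪x, y⟫ - h x ≤ conjugateOn S h y :=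
  le_affineSup (norm_coe_le_of_subset_closedBall hS) (image_eq_range h S ▸ hb) ⟨x, hx⟩ y

lemma lipschitzWith_conjugateOn (hne : S.Nonempty) (hS : S ⊆ closedBall 0 r)
    (hb : BddBelow (h '' S)) : LipschitzWith r (conjugateOn S h) :=
  have := hne.to_subtype
  lipschitzWith_affineSup (norm_coe_le_of_subset_closedBall hS) (image_eq_range h S ▸ hb)

lemma convexOn_conjugateOn (hne : S.Nonempty) (hS : S ⊆ closedBall 0 r)
    (hb : BddBelow (h '' S)) : ConvexOn ℝ univ (conjugateOn S h) :=
  have := hne.to_subtype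
  convexOn_affineSup (norm_coe_le_of_subset_closedBall hS) (image_eq_range h S ▸ hb)

lemma exists_isSubgradientAt_conjugateOn (hne : S.Nonempty) (hS : IsCompact S)
    (hh : ContinuousOn h S) (y : F) : ∃ x, IsSubgradientAt (conjugateOn S h) x y := by
  obtain ⟨x, hx, hmax⟩ := hS.exists_isMaxOn hne
    (show ContinuousOn (fun x => ⟪x, y⟫ - h x) S by fun_prop)
  obtain ⟨r, hr⟩ := hS.isBounded.subset_closedBall 0
  have hr' : S ⊆ closedBall 0 r.toNNReal :=
    hr.trans (closedBall_subset_closedBall r.le_coe_toNNReal)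
  have hb := hS.bddBelow_image hh
  have hattained : conjugateOn S h y = ⟪x, y⟫ - h x :=
    le_antisymm (conjugateOn_le hne fun z hz => hmax hz) (inner_sub_le_conjugateOn hr' hb hx y)
  exact ⟨x, isSubgradientAt_affineSup (i := ⟨x, hx⟩) (norm_coe_le_of_subset_closedBall hr')
    (image_eq_range h S ▸ hb) hattained⟩

variable [ProperSpace F]

lemma lipschitzWith_conjugateOn_closedBall (hh : Continuous h) :
    LipschitzWith r (conjugateOn (closedBall 0 (r : ℝ)) h) :=
  lipschitzWith_conjugateOn (nonempty_closedBall.2 r.2) subset_rfl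
    (bddBelow_image_closedBall hh 0 r)

lemma convexOn_conjugateOn_closedBall (hh : Continuous h) :
    ConvexOn ℝ univ (conjugateOn (closedBall 0 (r : ℝ)) h) :=
  convexOn_conjugateOn (nonempty_closedBall.2 r.2) subset_rfl (bddBelow_image_closedBall hh 0 r)

lemma inner_le_conjugateOn_closedBall_add (hh : Continuous h) {x : F} (hx : ‖x‖ ≤ r) (y : F) :
    ⟪x, y⟫ ≤ conjugateOn (closedBall 0 (r : ℝ)) h y + h x :=
  sub_le_iff_le_add.1 <| inner_sub_le_conjugateOn subset_rfl (bddBelow_image_closedBall hh 0 r)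
    (mem_closedBall_zero_iff.2 hx) y

/-- The transform of the average of `a` with the transform of `v`, the competitor in the comparison
of `v` with an optimal potential. -/
def averageConjugate (R r : ℝ≥0) (a v : F → ℝ) : F → ℝ :=
  conjugateOn (closedBall 0 (R : ℝ))
    (fun y => (a y + conjugateOn (closedBall 0 (r : ℝ)) v y) / 2)

/-- The transform of an average is dominated by an infimal convolution of the transforms: shift the
argument by `k` in one summand and by `-k` in the other. -/
lemma two_mul_averageConjugate_le {R : ℝ≥0} {a v : F → ℝ} (ha : Continuous a) (hv : Continuous v)
    {x k : F} (hxk : ‖x - k‖ ≤ r) :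
    2 * averageConjugate R r a v x ≤ conjugateOn (closedBall 0 (R : ℝ)) a (x + k) + v (x - k) := by
  rw [← le_div_iff₀' two_pos]
  refine conjugateOn_le (nonempty_closedBall.2 R.2) fun y hy => ?_
  have h₁ := inner_le_conjugateOn_closedBall_add ha (mem_closedBall_zero_iff.1 hy) (x + k)
  have h₂ := inner_le_conjugateOn_closedBall_add hv hxk y
  rw [inner_add_right] at h₁
  rw [inner_sub_left, real_inner_comm y x, real_inner_comm y k] at h₂
  linarith

end ConjugateOn

section SecondDiff

variable {V : Type*} [NormedAddCommGroup V]

/-- The symmetric second difference of `w` at `x` in the direction `k`. -/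
def secondDiff (w : V → ℝ) (k x : V) : ℝ :=
  w (x + k) + w (x - k) - 2 * w x

lemma continuous_secondDiff {w : V → ℝ} (hw : Continuous w) (k : V) :
    Continuous (secondDiff w k) := by
  unfold secondDiff
  fun_prop

lemma secondDiff_nonneg [NormedSpace ℝ V] {w : V → ℝ} (hw : ConvexOn ℝ univ w) (k x : V) :
    0 ≤ secondDiff w k x := by
  have hmid := hw.2 (mem_univ (x + k)) (mem_univ (x - k)) (by norm_num : (0 : ℝ) ≤ 1 / 2)
    (by norm_num : (0 : ℝ) ≤ 1 / 2) (by norm_num)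
  rw [← smul_add, add_add_sub_cancel, ← two_smul ℝ, smul_smul] at hmid
  norm_num at hmid
  unfold secondDiff
  linarith

lemma abs_inner_sub_le_of_isSubgradientAt {F : Type*} [NormedAddCommGroup F] [InnerProductSpace ℝ F]
    {u v : F → ℝ} {p q x k : F} {s : ℝ} (hp : IsSubgradientAt u p x) (hq : IsSubgradientAt v q x)
    (h₁ : 2 * s ≤ u (x + k) + v (x - k)) (h₂ : 2 * s ≤ u (x - k) + v (x + k)) :
    |⟪p - q, k⟫| ≤ u x + v x - 2 * s + (secondDiff u k x + secondDiff v k x) := by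
  have hpadd := hp (x + k)
  have hpsub := hp (x - k)
  have hqadd := hq (x + k)
  have hqsub := hq (x - k)
  rw [add_sub_cancel_left] at hpadd hqadd
  rw [sub_sub_cancel_left, inner_neg_right] at hpsub hqsub
  rw [inner_sub_left, secondDiff, secondDiff, abs_le]
  constructor <;> linarith

/-- A cutoff function that equals one on the ball of radius `R` and vanishes outside the ball of
radius `2 * R`. -/
def cutoff {R : ℝ} (hR : 0 < R) (x : V) : ℝ :=
  thickenedIndicator hR (closedBall 0 R) x

lemma cutoff_nonneg {R : ℝ} (hR : 0 < R) (x : V) : 0 ≤ cutoff hR x :=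
  NNReal.coe_nonneg _

lemma cutoff_eq_one {R : ℝ} (hR : 0 < R) {x : V} (hx : ‖x‖ ≤ R) : cutoff hR x = 1 := by
  rw [cutoff, thickenedIndicator_one hR _ (mem_closedBall_zero_iff.2 hx), NNReal.coe_one]

lemma cutoff_eq_zero [NormedSpace ℝ V] {R : ℝ} (hR : 0 < R) {x : V} (hx : 2 * R ≤ ‖x‖) :
    cutoff hR x = 0 := by
  rw [cutoff, thickenedIndicator_zero hR, NNReal.coe_zero]
  rw [thickening_closedBall hR hR.le, mem_ball_zero_iff]
  linarith

lemma lipschitzWith_cutoff {R : ℝ≥0} (hR : 0 < (R : ℝ)) :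
    LipschitzWith R⁻¹ (cutoff hR : V → ℝ) := by
  have h := NNReal.isometry_coe.lipschitz.comp
    (lipschitzWith_thickenedIndicator hR (closedBall (0 : V) R))
  rwa [one_mul, Real.toNNReal_coe] at h

lemma hasCompactSupport_cutoff [NormedSpace ℝ V] [ProperSpace V] {R : ℝ} (hR : 0 < R) :
    HasCompactSupport (cutoff hR : V → ℝ) :=
  .intro (isCompact_closedBall 0 (2 * R)) fun _ hx => cutoff_eq_zero hR
    (not_le.1 (mt mem_closedBall_zero_iff.2 hx)).le

variable [MeasurableSpace V] [BorelSpace V] {vol : Measure V}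

lemma integrable_of_continuous [ProperSpace V] {μ : Measure V} [IsFiniteMeasure μ] {R : ℝ}
    (hμ : ∀ᵐ x ∂μ, x ∈ closedBall 0 R) {w : V → ℝ} (hw : Continuous w) : Integrable w μ := by
  rw [← Measure.restrict_eq_self_of_ae_mem hμ]
  exact hw.continuousOn.integrableOn_compact (isCompact_closedBall 0 R)

lemma integral_mul_secondDiff [vol.IsAddRightInvariant] [IsFiniteMeasureOnCompacts vol]
    {χ w : V → ℝ} (hχ : Continuous χ) (hχc : HasCompactSupport χ) (hw : Continuous w) (k : V) :
    ∫ x, χ x * secondDiff w k x ∂vol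
      = ∫ x, (χ x - χ (x + k)) * (w (x + k) - w x) ∂vol := by
  have hint {f : V → ℝ} (hf : Continuous f) : Integrable (fun x => χ x * f x) vol :=
    (hχ.mul hf).integrable_of_hasCompactSupport hχc.mul_right
  have hforward := hint (f := fun x => w (x + k) - w x) (by fun_prop)
  have hbackward := hint (f := fun x => w x - w (x - k)) (by fun_prop)
  have hshifted : Integrable (fun x => χ (x + k) * (w (x + k) - w x)) vol := by
    simpa only [add_sub_cancel_right] using hbackward.comp_add_right k
  calc ∫ x, χ x * secondDiff w k x ∂vol
      = ∫ x, χ x * (w (x + k) - w x) - χ x * (w x - w (x - k)) ∂vol := by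
        congr with x
        rw [secondDiff]
        ring
    _ = ∫ x, χ x * (w (x + k) - w x) ∂vol - ∫ x, χ (x + k) * (w (x + k) - w x) ∂vol := by
        rw [integral_sub hforward hbackward,
          ← integral_add_right_eq_self (fun x => χ x * (w x - w (x - k))) k]
        simp only [add_sub_cancel_right]
    _ = ∫ x, (χ x - χ (x + k)) * (w (x + k) - w x) ∂vol := by
        rw [← integral_sub hforward hshifted]
        exact integral_congr_ae (.of_forall fun x => (sub_mul _ _ _).symm)

variable [NormedSpace ℝ V] [FiniteDimensional ℝ V] [vol.IsAddHaarMeasure]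

lemma integral_cutoff_mul_secondDiff_le {R K : ℝ≥0} (hR : 0 < (R : ℝ)) {w : V → ℝ}
    (hw : LipschitzWith K w) {k : V} (hk : ‖k‖ ≤ R) :
    ∫ x, cutoff hR x * secondDiff w k x ∂vol
      ≤ K / R * ‖k‖ ^ 2 * vol.real (closedBall 0 (3 * R)) := by
  have hproper : ProperSpace V := FiniteDimensional.proper_real V
  have hχ := lipschitzWith_cutoff (V := V) hR
  have hzero (x) (hx : x ∉ closedBall (0 : V) (3 * R)) :
      (cutoff hR x - cutoff hR (x + k)) * (w (x + k) - w x) = 0 := by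
    rw [mem_closedBall_zero_iff, not_le] at hx
    have htri : ‖x‖ ≤ ‖x + k‖ + ‖k‖ := norm_le_add_norm_add x k
    rw [cutoff_eq_zero hR (by linarith), cutoff_eq_zero hR (by linarith), sub_zero, zero_mul]
  have hbound (x : V) :
      ‖(cutoff hR x - cutoff hR (x + k)) * (w (x + k) - w x)‖ ≤ K / R * ‖k‖ ^ 2 := by
    have hχx := hχ.norm_sub_le x (x + k)
    have hwx := hw.norm_sub_le (x + k) x
    rw [sub_add_cancel_left, norm_neg] at hχx
    rw [add_sub_cancel_left] at hwx
    calc _ ≤ (R⁻¹ : ℝ≥0) * ‖k‖ * (K * ‖k‖) := by rw [norm_mul]; gcongr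
      _ = K / R * ‖k‖ ^ 2 := by rw [NNReal.coe_inv]; ring
  rw [integral_mul_secondDiff hχ.continuous (hasCompactSupport_cutoff hR) hw.continuous,
    ← setIntegral_eq_integral_of_forall_compl_eq_zero hzero]
  exact (Real.le_norm_self _).trans <| norm_setIntegral_le_of_norm_le_const
    (isCompact_closedBall _ _).measure_lt_top fun x _ => hbound x

/-- The mean of `secondDiff w k` is of order `‖k‖ ^ 2`, as if `w` were twice differentiable: the
second difference is nonnegative, so `μ` can be replaced by a multiple of `vol` with a Lipschitz
cutoff, where summation by parts applies. -/
lemma integral_secondDiff_le {μ : Measure V} {R K M : ℝ≥0} (hR : 0 < (R : ℝ))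
    (hμ : ∀ᵐ x ∂μ, x ∈ closedBall 0 (R : ℝ)) (hden : μ ≤ M • vol) {w : V → ℝ}
    (hw : LipschitzWith K w) (hconv : ConvexOn ℝ univ w) {k : V} (hk : ‖k‖ ≤ R) :
    ∫ x, secondDiff w k x ∂μ ≤ M * (K / R * ‖k‖ ^ 2 * vol.real (closedBall 0 (3 * R))) := by
  have hproper : ProperSpace V := FiniteDimensional.proper_real V
  have hint : Integrable (fun x => cutoff hR x * secondDiff w k x) vol :=
    ((lipschitzWith_cutoff hR).continuous.mul
      (continuous_secondDiff hw.continuous k)).integrable_of_hasCompactSupport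
      (hasCompactSupport_cutoff hR).mul_right
  calc ∫ x, secondDiff w k x ∂μ = ∫ x, cutoff hR x * secondDiff w k x ∂μ := by
        refine integral_congr_ae ?_
        filter_upwards [hμ] with x hx
        rw [cutoff_eq_one hR (mem_closedBall_zero_iff.1 hx), one_mul]
    _ ≤ ∫ x, cutoff hR x * secondDiff w k x ∂(M • vol) :=
        integral_mono_measure hden
          (.of_forall fun x => mul_nonneg (cutoff_nonneg hR x) (secondDiff_nonneg hconv k x))
          (hint.smul_measure_nnreal)
    _ = M * ∫ x, cutoff hR x * secondDiff w k x ∂vol := by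
        rw [integral_smul_nnreal_measure, NNReal.smul_def, smul_eq_mul]
    _ ≤ _ := by
        gcongr
        exact integral_cutoff_mul_secondDiff_le hR hw hk

end SecondDiff

section Stability

lemma lintegral_enorm_le_ofReal_integral {α G : Type*} [MeasurableSpace α] {μ : Measure α}
    [NormedAddCommGroup G] {f : α → G} {g : α → ℝ} (hg : Integrable g μ)
    (hfg : ∀ᵐ x ∂μ, ‖f x‖ ≤ g x) : ∫⁻ x, ‖f x‖ₑ ∂μ ≤ ENNReal.ofReal (∫ x, g x ∂μ) := by
  rw [ofReal_integral_eq_lintegral_ofReal hg (hfg.mono fun x hx => (norm_nonneg _).trans hx)]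
  refine lintegral_mono_ae (hfg.mono fun x hx => ?_)
  rw [← ofReal_norm]
  exact ENNReal.ofReal_le_ofReal hx

variable {F : Type*} [NormedAddCommGroup F] [InnerProductSpace ℝ F] {R r M : ℝ≥0} {a v : F → ℝ}

lemma norm_le_sum_abs_inner {ι : Type*} [Fintype ι] (e : OrthonormalBasis ι ℝ F) (z : F) :
    ‖z‖ ≤ ∑ i, |⟪z, e i⟫| := by
  conv_lhs => rw [← e.sum_repr' z]
  refine (norm_sum_le _ _).trans_eq (Finset.sum_congr rfl fun i _ => ?_)
  rw [norm_smul, e.norm_eq_one, mul_one, Real.norm_eq_abs, real_inner_comm]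

/-- The bound for `|⟨p - q, k⟩|`, where `p` is a subgradient at `x` of the transform of `a` and `q`
is one of `v`: the loss in passing to the competitor `averageConjugate`, and the second
differences. -/
def directionalGap (R : ℝ≥0) (a v : F → ℝ) (k x : F) : ℝ :=
  conjugateOn (closedBall 0 (R : ℝ)) a x + v x - 2 * averageConjugate R (2 * R) a v x
    + (secondDiff (conjugateOn (closedBall 0 (R : ℝ)) a) k x + secondDiff v k x)

lemma continuous_averageConjugate [ProperSpace F] (ha : Continuous a) (hv : Continuous v) :
    Continuous (averageConjugate R r a v) :=
  have hv' := (lipschitzWith_conjugateOn_closedBall (r := r) hv).continuous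
  (lipschitzWith_conjugateOn_closedBall (by fun_prop)).continuous

lemma continuous_directionalGap [ProperSpace F] (ha : Continuous a) (hv : Continuous v) (k : F) :
    Continuous (directionalGap R a v k) :=
  have ha' := (lipschitzWith_conjugateOn_closedBall (r := R) ha).continuous
  ((ha'.add hv).sub ((continuous_averageConjugate ha hv).const_mul 2)).add
    ((continuous_secondDiff ha' k).add (continuous_secondDiff hv k))

lemma abs_inner_sub_le_directionalGap [ProperSpace F] (ha : Continuous a)
    (hv : Continuous v) {p q x k : F}
    (hp : IsSubgradientAt (conjugateOn (closedBall 0 (R : ℝ)) a) p x) (hq : IsSubgradientAt v q x)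
    (hx : ‖x‖ ≤ R) (hk : ‖k‖ ≤ R) : |⟪p - q, k⟫| ≤ directionalGap R a v k x := by
  have hsub : ‖x - k‖ ≤ (2 * R : ℝ≥0) := by
    push_cast
    linarith [norm_sub_le x k]
  have hadd : ‖x - -k‖ ≤ (2 * R : ℝ≥0) := by
    push_cast
    linarith [norm_sub_le x (-k), norm_neg k]
  have hnegative := two_mul_averageConjugate_le (R := R) ha hv hadd
  rw [sub_neg_eq_add, ← sub_eq_add_neg] at hnegative
  exact abs_inner_sub_le_of_isSubgradientAt hp hq (two_mul_averageConjugate_le ha hv hsub) hnegative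

variable [MeasurableSpace F]

/-- The semi-dual functional `∫ w^* dμ + ∫ w dν` of optimal transport with quadratic cost, the
transform `w^*` being taken over the ball of radius `R`, which has to support `ν`. -/
def semidual (μ ν : Measure F) (R : ℝ≥0) (w : F → ℝ) : ℝ :=
  ∫ x, conjugateOn (closedBall 0 (R : ℝ)) w x ∂μ + ∫ y, w y ∂ν

variable [BorelSpace F] {μ ν : Measure F} [IsFiniteMeasure μ]

lemma integral_add_sub_averageConjugate_le [ProperSpace F] [IsFiniteMeasure ν]
    (hμ : ∀ᵐ x ∂μ, x ∈ closedBall 0 (R : ℝ)) (hν : ∀ᵐ y ∂ν, y ∈ closedBall 0 (R : ℝ))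
    (ha : Continuous a) (hv : Continuous v)
    (hmin : ∀ w, Continuous w → semidual μ ν R a ≤ semidual μ ν R w) :
    ∫ x, (conjugateOn (closedBall 0 (R : ℝ)) a x + v x - 2 * averageConjugate R r a v x) ∂μ
      ≤ ∫ x, v x ∂μ + ∫ y, conjugateOn (closedBall 0 (r : ℝ)) v y ∂ν - semidual μ ν R a := by
  have hv' : Continuous (conjugateOn (closedBall 0 (r : ℝ)) v) :=
    (lipschitzWith_conjugateOn_closedBall hv).continuous
  have haverage : Continuous fun y => (a y + conjugateOn (closedBall 0 (r : ℝ)) v y) / 2 := by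
    fun_prop
  have ha' : Continuous (conjugateOn (closedBall 0 (R : ℝ)) a) :=
    (lipschitzWith_conjugateOn_closedBall ha).continuous
  have hs : Continuous (averageConjugate R r a v) := continuous_averageConjugate ha hv
  have hcompare := hmin _ haverage
  have hsplit := integral_add (integrable_of_continuous hν ha) (integrable_of_continuous hν hv')
  rw [integral_sub (integrable_of_continuous hμ (by fun_prop))
    (integrable_of_continuous hμ (by fun_prop)), integral_add (integrable_of_continuous hμ ha')
    (integrable_of_continuous hμ hv), integral_const_mul]
  simp only [semidual, averageConjugate, integral_div] at hcompare hsplit ⊢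
  rw [hsplit] at hcompare
  linarith

variable [FiniteDimensional ℝ F] {vol : Measure F} [vol.IsAddHaarMeasure]

lemma integral_directionalGap_le [IsFiniteMeasure ν] (hR : 0 < (R : ℝ))
    (hμ : ∀ᵐ x ∂μ, x ∈ closedBall 0 (R : ℝ)) (hν : ∀ᵐ y ∂ν, y ∈ closedBall 0 (R : ℝ))
    (hden : μ ≤ M • vol) (ha : Continuous a)
    (hmin : ∀ w, Continuous w → semidual μ ν R a ≤ semidual μ ν R w)
    (hv : LipschitzWith R v) (hvconv : ConvexOn ℝ univ v) {k : F} (hk : ‖k‖ ≤ R) :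
    ∫ x, directionalGap R a v k x ∂μ
      ≤ ∫ x, v x ∂μ + ∫ y, conjugateOn (closedBall 0 ((2 * R : ℝ≥0) : ℝ)) v y ∂ν
        - semidual μ ν R a + 2 * M * vol.real (closedBall 0 (3 * R)) * ‖k‖ ^ 2 := by
  have hproper : ProperSpace F := FiniteDimensional.proper_real F
  have hu : LipschitzWith R (conjugateOn (closedBall 0 (R : ℝ)) a) :=
    lipschitzWith_conjugateOn_closedBall ha
  have hloss := integral_add_sub_averageConjugate_le (r := 2 * R) hμ hν ha hv.continuous hmin
  have hsecond_u := integral_secondDiff_le hR hμ hden hu (convexOn_conjugateOn_closedBall ha) hk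
  have hsecond_v := integral_secondDiff_le hR hμ hden hv hvconv hk
  have hu' := hu.continuous
  have hv' := hv.continuous
  have hs : Continuous (averageConjugate R (2 * R) a v) := continuous_averageConjugate ha hv'
  have hdiff_u := continuous_secondDiff hu' k
  have hdiff_v := continuous_secondDiff hv' k
  simp only [directionalGap]
  rw [integral_add (integrable_of_continuous hμ (by fun_prop))
    (integrable_of_continuous hμ (by fun_prop)),
    integral_add (integrable_of_continuous hμ hdiff_u) (integrable_of_continuous hμ hdiff_v)]
  rw [div_self hR.ne', one_mul] at hsecond_u hsecond_v
  linarith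

/-- The gap between the value of the pair `(v, v^*)` and the minimum of the semi-dual functional
controls the distance between subgradients. Along a basis direction `k` of length `t`, the
subgradients are compared through the competitor `averageConjugate`, at the price of the second
differences in the direction `k`, which have mean of order `t ^ 2`. -/
theorem lintegral_enorm_sub_le [IsFiniteMeasure ν] (hR : 0 < (R : ℝ))
    (hμ : ∀ᵐ x ∂μ, x ∈ closedBall 0 (R : ℝ)) (hν : ∀ᵐ y ∂ν, y ∈ closedBall 0 (R : ℝ))
    (hden : μ ≤ M • vol) (ha : Continuous a)
    (hmin : ∀ w, Continuous w → semidual μ ν R a ≤ semidual μ ν R w)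
    (hv : LipschitzWith R v) (hvconv : ConvexOn ℝ univ v) {p q : F → F}
    (hp : ∀ᵐ x ∂μ, IsSubgradientAt (conjugateOn (closedBall 0 (R : ℝ)) a) (p x) x)
    (hq : ∀ᵐ x ∂μ, IsSubgradientAt v (q x) x) {t : ℝ} (ht : 0 < t) (htR : t ≤ R) :
    ∫⁻ x, ‖p x - q x‖ₑ ∂μ ≤ ENNReal.ofReal (Module.finrank ℝ F * (t⁻¹ *
      (∫ x, v x ∂μ + ∫ y, conjugateOn (closedBall 0 ((2 * R : ℝ≥0) : ℝ)) v y ∂ν - semidual μ ν R a)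
        + 2 * M * vol.real (closedBall 0 (3 * R)) * t)) := by
  have hproper : ProperSpace F := FiniteDimensional.proper_real F
  let e := stdOrthonormalBasis ℝ F
  have hnorm (i) : ‖t • e i‖ = t := by
    rw [norm_smul, e.norm_eq_one, mul_one, Real.norm_of_nonneg ht.le]
  have hint (i) : Integrable (fun x => t⁻¹ * directionalGap R a v (t • e i) x) μ :=
    (integrable_of_continuous hμ (continuous_directionalGap ha hv.continuous _)).const_mul _
  have hpointwise : ∀ᵐ x ∂μ, ‖p x - q x‖ ≤ ∑ i, t⁻¹ * directionalGap R a v (t • e i) x := by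
    filter_upwards [hp, hq, hμ] with x hpx hqx hx
    refine (norm_le_sum_abs_inner e _).trans (Finset.sum_le_sum fun i _ => ?_)
    have hgap := abs_inner_sub_le_directionalGap ha hv.continuous hpx hqx
      (mem_closedBall_zero_iff.1 hx) ((hnorm i).trans_le htR)
    rwa [inner_smul_right, abs_mul, abs_of_pos ht, ← le_inv_mul_iff₀ ht] at hgap
  refine (lintegral_enorm_le_ofReal_integral (integrable_finsetSum _ fun i _ => hint i)
    hpointwise).trans (ENNReal.ofReal_le_ofReal ?_)
  rw [integral_finsetSum _ fun i _ => hint i]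
  refine (Finset.sum_le_card_nsmul Finset.univ _ _ fun i _ => ?_).trans_eq
    (by rw [Finset.card_fin, nsmul_eq_mul])
  have hgap := integral_directionalGap_le hR hμ hν hden ha hmin hv hvconv ((hnorm i).trans_le htR)
  rw [hnorm i] at hgap
  rw [integral_const_mul, inv_mul_le_iff₀ ht]
  refine hgap.trans_eq ?_
  field_simp

end Stability

section Quantization

variable {X : Type*} [MeasurableSpace X]

/-- The `ℓ¹` distance between the masses that `μ` and `ν` give to the cells of the quantizer `q`. -/
def quantizationError (μ ν : Measure X) (q : SimpleFunc X X) : ℝ :=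
  ∑ c ∈ q.range, |μ.real (q ⁻¹' {c}) - ν.real (q ⁻¹' {c})|

lemma sum_measureReal_fiber (μ : Measure X) [IsProbabilityMeasure μ] (q : SimpleFunc X X) :
    ∑ c ∈ q.range, μ.real (q ⁻¹' {c}) = 1 := by
  rw [sum_measureReal_preimage_singleton _ fun c _ => q.measurableSet_fiber c,
    SimpleFunc.coe_range, preimage_range, probReal_univ]

lemma integral_comp_simpleFunc (μ : Measure X) [IsFiniteMeasure μ] (q : SimpleFunc X X)
    (g : X → ℝ) : ∫ x, g (q x) ∂μ = ∑ c ∈ q.range, μ.real (q ⁻¹' {c}) * g c := by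
  have hsum (x : X) : g (q x) = ∑ c ∈ q.range, (q ⁻¹' {c}).indicator (fun _ => g c) x := by
    rw [Finset.sum_eq_single_of_mem (q x) (q.mem_range_self x)]
    · exact (indicator_of_mem (show x ∈ q ⁻¹' {q x} from rfl) fun _ => g (q x)).symm
    · exact fun c _ hc => indicator_of_notMem (mt Eq.symm hc) _
  simp only [hsum]
  rw [integral_finsetSum _ fun c _ =>
    (integrable_const (g c)).indicator (q.measurableSet_fiber c)]
  simp only [integral_indicator_const _ (q.measurableSet_fiber _), smul_eq_mul]

variable [PseudoMetricSpace X]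

/-- The integrals of `L`-Lipschitz functions against `μ` and `ν` differ by at most `L * δ`. By
Kantorovich-Rubinstein duality, this is a bound on the `1`-Wasserstein distance. -/
def LipschitzDiscrepancyLE (μ ν : Measure X) (δ : ℝ) : Prop :=
  ∀ ⦃L : ℝ≥0⦄ ⦃w : X → ℝ⦄, LipschitzWith L w → |∫ x, w x ∂μ - ∫ x, w x ∂ν| ≤ L * δ

lemma LipschitzDiscrepancyLE.nonneg {μ ν : Measure X} {δ : ℝ} (h : LipschitzDiscrepancyLE μ ν δ) :
    0 ≤ δ := by
  simpa using h (LipschitzWith.const' (0 : ℝ) : LipschitzWith 1 fun _ : X => (0 : ℝ))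

lemma abs_integral_sub_integral_comp_le [OpensMeasurableSpace X] {μ : Measure X}
    [IsProbabilityMeasure μ] {q : SimpleFunc X X} {ε : ℝ} (hμ : ∀ᵐ x ∂μ, dist x (q x) ≤ ε)
    {L : ℝ≥0} {w : X → ℝ} (hw : LipschitzWith L w) :
    |∫ x, w x ∂μ - ∫ x, w (q x) ∂μ| ≤ L * ε := by
  have hbound : ∀ᵐ x ∂μ, ‖w x - w (q x)‖ ≤ L * ε := by
    filter_upwards [hμ] with x hx
    rw [← dist_eq_norm]
    exact (hw.dist_le_mul x (q x)).trans (by gcongr)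
  have hq : Integrable (fun x => w (q x)) μ := (q.map w).integrable_of_isFiniteMeasure
  have hdiff : Integrable (fun x => w x - w (q x)) μ :=
    .of_bound (hw.continuous.aestronglyMeasurable.sub hq.aestronglyMeasurable) _ hbound
  have hint : Integrable w μ := (hdiff.add hq).congr (.of_forall fun x => sub_add_cancel _ _)
  rw [← integral_sub hint hq, ← Real.norm_eq_abs]
  simpa using norm_integral_le_of_norm_le_const hbound

lemma abs_integral_comp_sub_le {μ ν : Measure X} [IsProbabilityMeasure μ] [IsProbabilityMeasure ν]
    {q : SimpleFunc X X} {x₀ : X} {ρ : ℝ} (hq : ∀ x, dist (q x) x₀ ≤ ρ) {L : ℝ≥0} {w : X → ℝ}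
    (hw : LipschitzWith L w) :
    |∫ x, w (q x) ∂μ - ∫ x, w (q x) ∂ν| ≤ L * (ρ * quantizationError μ ν q) := by
  have hcenter : ∑ c ∈ q.range, (μ.real (q ⁻¹' {c}) - ν.real (q ⁻¹' {c})) * w x₀ = 0 := by
    rw [← Finset.sum_mul, Finset.sum_sub_distrib, sum_measureReal_fiber, sum_measureReal_fiber,
      sub_self, zero_mul]
  calc |∫ x, w (q x) ∂μ - ∫ x, w (q x) ∂ν|
      = |∑ c ∈ q.range, (μ.real (q ⁻¹' {c}) - ν.real (q ⁻¹' {c})) * (w c - w x₀)| := by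
        simp only [mul_sub, Finset.sum_sub_distrib]
        rw [hcenter, sub_zero, integral_comp_simpleFunc, integral_comp_simpleFunc]
        simp only [sub_mul, Finset.sum_sub_distrib]
    _ ≤ ∑ c ∈ q.range, |μ.real (q ⁻¹' {c}) - ν.real (q ⁻¹' {c})| * (L * ρ) := by
        refine (Finset.abs_sum_le_sum_abs _ _).trans (Finset.sum_le_sum fun c hc => ?_)
        obtain ⟨x, rfl⟩ := SimpleFunc.mem_range.1 hc
        rw [abs_mul, ← Real.dist_eq (w _)]
        gcongr
        exact (hw.dist_le_mul _ _).trans (by gcongr; exact hq x)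
    _ = L * (ρ * quantizationError μ ν q) := by
        rw [← Finset.sum_mul, quantizationError]
        ring

theorem lipschitzDiscrepancyLE_of_quantizer [OpensMeasurableSpace X] {μ ν : Measure X}
    [IsProbabilityMeasure μ] [IsProbabilityMeasure ν] {q : SimpleFunc X X} {ε ρ : ℝ} {x₀ : X}
    (hμ : ∀ᵐ x ∂μ, dist x (q x) ≤ ε) (hν : ∀ᵐ x ∂ν, dist x (q x) ≤ ε)
    (hq : ∀ x, dist (q x) x₀ ≤ ρ) :
    LipschitzDiscrepancyLE μ ν (2 * ε + ρ * quantizationError μ ν q) := by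
  intro L w hw
  have h₁ := abs_integral_sub_integral_comp_le hμ hw
  have h₂ := abs_integral_comp_sub_le (μ := μ) (ν := ν) hq hw
  have h₃ := abs_integral_sub_integral_comp_le hν hw
  rw [abs_le] at *
  constructor <;> linarith

end Quantization

section Covering

lemma exists_simpleFunc_nearest {X : Type*} [PseudoEMetricSpace X] [MeasurableSpace X]
    [OpensMeasurableSpace X] {s : Finset X} (hs : s.Nonempty) :
    ∃ q : SimpleFunc X X, (∀ x, q x ∈ s) ∧ ∀ x, ∀ c ∈ s, edist (q x) x ≤ edist c x := by
  obtain ⟨c₀, hc₀⟩ := hs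
  obtain ⟨enum, hmem, hsurj⟩ : ∃ enum : ℕ → X, (∀ k, enum k ∈ s) ∧ ∀ c ∈ s, ∃ k ≤ s.card,
      enum k = c := by
    refine ⟨fun k => s.toList.getD k c₀, fun k => ?_, fun c hc => ?_⟩
    · rcases lt_or_ge k s.toList.length with hk | hk
      · simpa only [List.getD_eq_getElem _ _ hk] using Finset.mem_toList.1 (List.getElem_mem hk)
      · simpa only [List.getD_eq_default _ _ hk] using hc₀
    · obtain ⟨k, hk, rfl⟩ := List.getElem_of_mem (Finset.mem_toList.2 hc)
      exact ⟨k, s.length_toList ▸ hk.le, List.getD_eq_getElem _ _ hk⟩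
  refine ⟨.nearestPt enum s.card, fun x => hmem _, fun x c hc => ?_⟩
  obtain ⟨k, hk, rfl⟩ := hsurj c hc
  exact SimpleFunc.edist_nearestPt_le _ _ hk

variable {V : Type*} [NormedAddCommGroup V] [NormedSpace ℝ V] [FiniteDimensional ℝ V] {R ε : ℝ≥0}

/-- The balls of radius `ε / 2` around the points of `s` are disjoint and contained in the ball of
radius `R + ε / 2`; compare volumes. -/
lemma card_le_of_isSeparated (hε : 0 < ε) {s : Finset V} (hs : (s : Set V) ⊆ closedBall 0 R)
    (hsep : IsSeparated ε (s : Set V)) :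
    (s.card : ℝ) ≤ (1 + 2 * R / ε) ^ Module.finrank ℝ V := by
  borelize V
  let vol : Measure V := Measure.addHaar
  have hε' : (0 : ℝ) < ε := hε
  have hdisjoint : (s : Set V).PairwiseDisjoint fun c => ball c (ε / 2) := fun c hc e he hce => by
    refine ball_disjoint_ball ?_
    rw [add_halves]
    have h : (ε : ENNReal) < edist c e := hsep hc he hce
    rw [edist_nndist, ENNReal.coe_lt_coe, ← NNReal.coe_lt_coe, coe_nndist] at h
    exact h.le
  have hsubset : ⋃ c ∈ s, ball c (ε / 2) ⊆ ball (0 : V) (R + ε / 2) :=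
    iUnion₂_subset fun c hc => ball_subset_ball' <| by
      rw [add_comm]
      gcongr
      exact hs hc
  have hball (c : V) {r : ℝ} (hr : 0 < r) :
      vol.real (ball c r) = r ^ Module.finrank ℝ V * vol.real (ball 0 1) := by
    rw [Measure.real, Measure.addHaar_ball_of_pos vol c hr, ENNReal.toReal_mul,
      ENNReal.toReal_ofReal (by positivity), Measure.real]
  have hvolume : s.card * ((ε / 2 : ℝ) ^ Module.finrank ℝ V * vol.real (ball 0 1))
      ≤ (R + ε / 2) ^ Module.finrank ℝ V * vol.real (ball 0 1) := by
    have h := measureReal_mono hsubset (μ := vol) measure_ball_lt_top.ne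
    rw [measureReal_biUnion_finset hdisjoint fun c _ => measurableSet_ball] at h
    simpa only [hball _ (half_pos hε'), hball _ (by positivity : (0 : ℝ) < R + ε / 2),
      Finset.sum_const, nsmul_eq_mul] using h
  have hunit : 0 < vol.real (ball 0 1) :=
    ENNReal.toReal_pos (measure_ball_pos vol _ one_pos).ne' measure_ball_lt_top.ne
  rw [← mul_assoc, mul_le_mul_iff_left₀ hunit] at hvolume
  calc (s.card : ℝ) ≤ (R + ε / 2) ^ Module.finrank ℝ V / (ε / 2) ^ Module.finrank ℝ V :=
        (le_div_iff₀ (by positivity)).2 hvolume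
    _ = (1 + 2 * R / ε) ^ Module.finrank ℝ V := by
        rw [← div_pow]
        congr 1
        field_simp
        ring

lemma packingNumber_closedBall_le (hε : 0 < ε) :
    packingNumber ε (closedBall (0 : V) R) ≤ ⌊(1 + 2 * R / ε : ℝ) ^ Module.finrank ℝ V⌋₊ := by
  refine iSup_le fun C => iSup₂_le fun hC hsep => ?_
  by_contra! hlt
  obtain ⟨t, htC, ht⟩ := exists_subset_encard_eq (Order.add_one_le_of_lt hlt)
  have hfin : t.Finite := finite_of_encard_eq_coe ht
  have hcard := card_le_of_isSeparated (s := hfin.toFinset) hε (by simpa using htC.trans hC)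
    (by simpa using hsep.subset htC)
  rw [hfin.encard_eq_coe_toFinset_card] at ht
  have hfloor := Nat.le_floor hcard
  exact hfloor.not_gt (ENat.natCast_inj.1 (ht.trans (Nat.cast_succ _).symm) ▸ Nat.lt_succ_self _)

lemma exists_finset_isCover_closedBall (hε : 0 < ε) :
    ∃ s : Finset V, (s : Set V) ⊆ closedBall 0 R ∧ IsCover ε (closedBall (0 : V) R) s ∧
      (s.card : ℝ) ≤ (1 + 2 * R / ε) ^ Module.finrank ℝ V := by
  have hpacking : packingNumber ε (closedBall (0 : V) R) ≠ ⊤ :=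
    ((packingNumber_closedBall_le hε).trans_lt (ENat.natCast_lt_top _)).ne
  have hfin : (maximalSeparatedSet ε (closedBall (0 : V) R)).Finite := by
    rw [← encard_lt_top_iff, encard_maximalSeparatedSet hpacking]
    exact hpacking.lt_top
  refine ⟨hfin.toFinset, ?_, ?_, ?_⟩
  · simpa using maximalSeparatedSet_subset
  · simpa using isCover_maximalSeparatedSet hpacking
  · refine card_le_of_isSeparated hε ?_ ?_
    · simpa using maximalSeparatedSet_subset
    · simpa using isSeparated_maximalSeparatedSet

lemma exists_simpleFunc_quantizer_closedBall [MeasurableSpace V] [OpensMeasurableSpace V]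
    (hε : 0 < ε) :
    ∃ q : SimpleFunc V V, (∀ x, q x ∈ closedBall 0 (R : ℝ)) ∧
      (∀ x ∈ closedBall 0 (R : ℝ), dist x (q x) ≤ ε) ∧
      (q.range.card : ℝ) ≤ (1 + 2 * R / ε) ^ Module.finrank ℝ V := by
  obtain ⟨s, hsR, hcover, hcard⟩ := exists_finset_isCover_closedBall (V := V) (R := R) hε
  have hs : s.Nonempty := by
    obtain ⟨c, hc, -⟩ := hcover (mem_closedBall_self R.coe_nonneg)
    exact ⟨c, hc⟩
  obtain ⟨q, hqs, hq⟩ := exists_simpleFunc_nearest hs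
  refine ⟨q, fun x => hsR (hqs x), fun x hx => ?_, ?_⟩
  · obtain ⟨c, hc, hxc : edist x c ≤ ε⟩ := hcover hx
    rw [edist_comm] at hxc
    have h := (hq x c hc).trans hxc
    rwa [edist_nndist, ENNReal.coe_le_coe, ← NNReal.coe_le_coe, coe_nndist, dist_comm] at h
  · refine le_trans (Nat.cast_le.2 (Finset.card_le_card fun c hc => ?_)) hcard
    obtain ⟨x, rfl⟩ := SimpleFunc.mem_range.1 hc
    exact hqs x

end Covering

section Empirical

variable {X ι Ω : Type*} [MeasurableSpace X] [Fintype ι] [MeasurableSpace Ω] {P : Measure Ω}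

/-- The empirical measure of the points `x i`: each of them is given the mass `1 / card ι`. -/
def empiricalMeasure (x : ι → X) : Measure X :=
  (Fintype.card ι : ENNReal)⁻¹ • ∑ i, Measure.dirac (x i)

instance isProbabilityMeasure_empiricalMeasure [Nonempty ι] (x : ι → X) :
    IsProbabilityMeasure (empiricalMeasure x) where
  measure_univ := by simp [empiricalMeasure, ENNReal.inv_mul_cancel]

lemma integral_empiricalMeasure [MeasurableSingletonClass X] (x : ι → X) (w : X → ℝ) :
    ∫ z, w z ∂empiricalMeasure x = (Fintype.card ι : ℝ)⁻¹ * ∑ i, w (x i) := by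
  rw [empiricalMeasure, integral_smul_measure,
    integral_finsetSum_measure fun i _ => integrable_dirac ENNReal.coe_lt_top]
  simp

lemma measureReal_empiricalMeasure (x : ι → X) {B : Set X} (hB : MeasurableSet B) :
    (empiricalMeasure x).real B = (Fintype.card ι : ℝ)⁻¹ * ∑ i, B.indicator 1 (x i) := by
  have hdirac (i : ι) : (Measure.dirac (x i)).real B = B.indicator 1 (x i) := by
    by_cases h : x i ∈ B <;> simp [Measure.real, Measure.dirac_apply' _ hB, h]
  rw [empiricalMeasure, measureReal_ennreal_smul_apply, ENNReal.toReal_inv, ENNReal.toReal_natCast,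
    Measure.real, Measure.finsetSum_apply, ENNReal.toReal_sum fun i _ => measure_ne_top _ _]
  exact congrArg _ (Finset.sum_congr rfl fun i _ => hdirac i)

lemma ae_empiricalMeasure {x : ι → X} {p : X → Prop} (hp : MeasurableSet {z | p z})
    (hx : ∀ i, p (x i)) : ∀ᵐ z ∂empiricalMeasure x, p z := by
  refine Measure.ae_smul_measure ?_ _
  rw [ae_iff, Measure.finsetSum_apply, Finset.sum_eq_zero]
  intro i _
  rw [← ae_iff, ae_dirac_iff hp]
  exact hx i

lemma variance_average_le {W : ι → Ω → ℝ} (hW : ∀ i, MemLp (W i) 2 P)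
    (hind : Pairwise fun i j => W i ⟂ᵢ[P] W j) {s : ℝ} (hs : ∀ i, variance (W i) P ≤ s) :
    variance (fun ω => (Fintype.card ι : ℝ)⁻¹ * ∑ i, W i ω) P ≤ s / Fintype.card ι := by
  have hsum : variance (fun ω => ∑ i, W i ω) P ≤ Fintype.card ι * s := by
    have h := IndepFun.variance_sum (s := Finset.univ) (fun i _ => hW i) (hind.set_pairwise _)
    rw [Finset.sum_fn] at h
    rw [h, ← nsmul_eq_mul]
    exact Finset.sum_le_card_nsmul _ _ _ fun i _ => hs i
  calc variance (fun ω => (Fintype.card ι : ℝ)⁻¹ * ∑ i, W i ω) P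
      = (Fintype.card ι : ℝ)⁻¹ ^ 2 * variance (fun ω => ∑ i, W i ω) P := variance_const_mul _ _ _
    _ ≤ (Fintype.card ι : ℝ)⁻¹ ^ 2 * (Fintype.card ι * s) := by gcongr
    _ = s / Fintype.card ι := by
        rcases eq_or_ne (Fintype.card ι : ℝ) 0 with h | h
        · simp [h]
        · field_simp

lemma integral_abs_le_sqrt_integral_sq [IsProbabilityMeasure P] {Y : Ω → ℝ} (hY : MemLp Y 2 P) :
    ∫ ω, |Y ω| ∂P ≤ √(∫ ω, Y ω ^ 2 ∂P) := by
  refine Real.le_sqrt_of_sq_le ?_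
  have h := variance_nonneg (fun ω => |Y ω|) P
  rw [variance_eq_sub (X := fun ω => |Y ω|) hY.abs] at h
  simpa only [Pi.pow_apply, sq_abs, sub_nonneg] using h

variable [IsProbabilityMeasure P] {μ : Measure X} {Z : ι → Ω → X} {B : Set X}

lemma memLp_indicator_comp {z : Ω → X} (hz : AEMeasurable z P) (hB : MeasurableSet B) :
    MemLp (fun ω => B.indicator (1 : X → ℝ) (z ω)) 2 P :=
  .of_bound ((measurable_one.indicator hB).comp_aemeasurable hz).aestronglyMeasurable 1 <|
    .of_forall fun ω => by by_cases h : z ω ∈ B <;> simp [h]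

lemma variance_indicator_comp_le {z : Ω → X} (hz : HasLaw z μ P) (hB : MeasurableSet B) :
    variance (fun ω => B.indicator (1 : X → ℝ) (z ω)) P ≤ μ.real B := by
  refine (variance_le_expectation_sq
    (memLp_indicator_comp hz.aemeasurable hB).aestronglyMeasurable).trans_eq ?_
  have hsq (x : X) : B.indicator (1 : X → ℝ) x ^ 2 = B.indicator 1 x := by
    by_cases h : x ∈ B <;> simp [h]
  simp only [Pi.pow_apply, hsq]
  rw [← integral_indicator_one hB]
  exact hz.integral_comp (measurable_one.indicator hB).aestronglyMeasurable

lemma memLp_measureReal_empiricalMeasure (hZ : ∀ i, AEMeasurable (Z i) P)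
    (hB : MeasurableSet B) : MemLp (fun ω => (empiricalMeasure fun i => Z i ω).real B) 2 P := by
  simp only [measureReal_empiricalMeasure _ hB]
  exact (memLp_finsetSum _ fun i _ => memLp_indicator_comp (hZ i) hB).const_mul _

lemma integral_measureReal_empiricalMeasure [Nonempty ι] (hZ : ∀ i, HasLaw (Z i) μ P)
    (hB : MeasurableSet B) :
    ∫ ω, (empiricalMeasure fun i => Z i ω).real B ∂P = μ.real B := by
  have hcell (i : ι) : ∫ ω, B.indicator (1 : X → ℝ) (Z i ω) ∂P = μ.real B := by
    rw [← integral_indicator_one hB]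
    exact (hZ i).integral_comp (measurable_one.indicator hB).aestronglyMeasurable
  simp only [measureReal_empiricalMeasure _ hB]
  rw [integral_const_mul, integral_finsetSum _ fun i _ =>
    (memLp_indicator_comp (hZ i).aemeasurable hB).integrable one_le_two]
  simp [hcell]

lemma integral_sq_measureReal_sub_empiricalMeasure_le [Nonempty ι] (hZ : ∀ i, HasLaw (Z i) μ P)
    (hind : Pairwise fun i j => Z i ⟂ᵢ[P] Z j) (hB : MeasurableSet B) :
    ∫ ω, (μ.real B - (empiricalMeasure fun i => Z i ω).real B) ^ 2 ∂P
      ≤ μ.real B / Fintype.card ι := by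
  have hZ' (i : ι) : AEMeasurable (Z i) P := (hZ i).aemeasurable
  have hvar := variance_eq_integral (memLp_measureReal_empiricalMeasure hZ' hB).aemeasurable
  rw [integral_measureReal_empiricalMeasure hZ hB] at hvar
  simp only [sub_sq_comm (μ.real B)]
  rw [← hvar]
  simp only [measureReal_empiricalMeasure _ hB]
  have hmeas : Measurable (B.indicator (1 : X → ℝ)) := measurable_one.indicator hB
  exact variance_average_le (fun i => memLp_indicator_comp (hZ' i) hB)
    (fun i j hij => (hind hij).comp hmeas hmeas) fun i => variance_indicator_comp_le (hZ i) hB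

lemma integrable_quantizationError (hZ : ∀ i, AEMeasurable (Z i) P)
    (q : SimpleFunc X X) :
    Integrable (fun ω => quantizationError μ (empiricalMeasure fun i => Z i ω) q) P :=
  integrable_finsetSum _ fun c _ => ((integrable_const _).sub <|
    (memLp_measureReal_empiricalMeasure hZ (q.measurableSet_fiber c)).integrable one_le_two).abs

lemma integral_quantizationError_le [Nonempty ι] [IsProbabilityMeasure μ]
    (hZ : ∀ i, HasLaw (Z i) μ P) (hind : Pairwise fun i j => Z i ⟂ᵢ[P] Z j)
    (q : SimpleFunc X X) :
    ∫ ω, quantizationError μ (empiricalMeasure fun i => Z i ω) q ∂P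
      ≤ √(q.range.card / Fintype.card ι) := by
  have hZ' (i : ι) : AEMeasurable (Z i) P := (hZ i).aemeasurable
  have hLp (c : X) : MemLp (fun ω => μ.real (q ⁻¹' {c}) -
      (empiricalMeasure fun i => Z i ω).real (q ⁻¹' {c})) 2 P :=
    (memLp_const _).sub (memLp_measureReal_empiricalMeasure hZ' (q.measurableSet_fiber c))
  simp only [quantizationError]
  calc _ = ∑ c ∈ q.range, ∫ ω, |μ.real (q ⁻¹' {c}) -
          (empiricalMeasure fun i => Z i ω).real (q ⁻¹' {c})| ∂P :=
        integral_finsetSum _ fun c _ => ((hLp c).integrable one_le_two).abs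
    _ ≤ ∑ c ∈ q.range, √(μ.real (q ⁻¹' {c})) * √(Fintype.card ι : ℝ)⁻¹ := by
        refine Finset.sum_le_sum fun c _ => (integral_abs_le_sqrt_integral_sq (hLp c)).trans ?_
        rw [← Real.sqrt_mul measureReal_nonneg, ← div_eq_mul_inv]
        exact Real.sqrt_le_sqrt
          (integral_sq_measureReal_sub_empiricalMeasure_le hZ hind (q.measurableSet_fiber c))
    _ ≤ √(∑ c ∈ q.range, μ.real (q ⁻¹' {c})) * √(∑ _ ∈ q.range, (Fintype.card ι : ℝ)⁻¹) :=
        Real.sum_sqrt_mul_sqrt_le _ (fun _ => measureReal_nonneg) fun _ => by positivity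
    _ = √(q.range.card / Fintype.card ι) := by
        rw [sum_measureReal_fiber, Real.sqrt_one, one_mul, Finset.sum_const, nsmul_eq_mul,
          div_eq_mul_inv]

lemma exists_integrable_lipschitzDiscrepancyLE {V : Type*} [NormedAddCommGroup V]
    [NormedSpace ℝ V] [FiniteDimensional ℝ V] [MeasurableSpace V] [BorelSpace V] [Nonempty ι]
    {μ : Measure V} [IsProbabilityMeasure μ] {R : ℝ≥0} (hμ : ∀ᵐ x ∂μ, x ∈ closedBall 0 (R : ℝ))
    {Z : ι → Ω → V} (hZ : ∀ i, HasLaw (Z i) μ P) (hind : Pairwise fun i j => Z i ⟂ᵢ[P] Z j)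
    {ε : ℝ≥0} (hε : 0 < ε) :
    ∃ D : Ω → ℝ, Integrable D P ∧
      (∀ᵐ ω ∂P, LipschitzDiscrepancyLE μ (empiricalMeasure fun i => Z i ω) (D ω)) ∧
      ∫ ω, D ω ∂P
        ≤ 2 * ε + R * √((1 + 2 * R / ε) ^ Module.finrank ℝ V / Fintype.card ι) := by
  obtain ⟨q, hqR, hqε, hqcard⟩ :=
    exists_simpleFunc_quantizer_closedBall (V := V) (R := R) hε
  have hint := integrable_quantizationError (μ := μ) (fun i => (hZ i).aemeasurable) q
  refine ⟨fun ω => 2 * ε + R * quantizationError μ (empiricalMeasure fun i => Z i ω) q,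
    (integrable_const _).add (hint.const_mul _), ?_, ?_⟩
  · have hmem : ∀ᵐ ω ∂P, ∀ i, Z i ω ∈ closedBall 0 (R : ℝ) :=
      ae_all_iff.2 fun i => ((hZ i).ae_iff measurableSet_closedBall.mem).2 hμ
    filter_upwards [hmem] with ω hω
    exact lipschitzDiscrepancyLE_of_quantizer (hμ.mono hqε)
      ((ae_empiricalMeasure measurableSet_closedBall hω).mono hqε) hqR
  · rw [integral_add (integrable_const _) (hint.const_mul _), integral_const,
      integral_const_mul, probReal_univ, one_smul]
    gcongr
    exact (integral_quantizationError_le hZ hind q).trans (by gcongr)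

lemma sqrt_one_add_div_pow_div_le {R a N : ℝ} {k : ℕ} (hR : 0 < R) (ha : 0 < a) (ha1 : a ≤ 1)
    (haN : a ^ (k + 2) = N⁻¹) : √((1 + 2 * R / (R * a)) ^ k / N) ≤ 3 ^ k * a := by
  have hcells : 1 + 2 * R / (R * a) ≤ 3 / a := by
    rw [mul_comm, mul_div_mul_left _ _ hR.ne', le_div_iff₀ ha, add_mul, div_mul_cancel₀ _ ha.ne']
    linarith
  refine Real.sqrt_le_iff.2 ⟨by positivity, ?_⟩
  calc (1 + 2 * R / (R * a)) ^ k / N ≤ (3 / a) ^ k * a ^ (k + 2) := by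
        rw [haN, div_eq_mul_inv]
        have : 0 ≤ N⁻¹ := haN ▸ by positivity
        gcongr
    _ = 3 ^ k * a ^ 2 := by
        rw [div_pow, pow_add]
        field_simp
    _ ≤ (3 ^ k) ^ 2 * a ^ 2 := by
        gcongr
        exact le_self_pow₀ (one_le_pow₀ (by norm_num)) two_ne_zero
    _ = (3 ^ k * a) ^ 2 := (mul_pow _ _ _).symm

theorem exists_integrable_lipschitzDiscrepancyLE_rate {V : Type*} [NormedAddCommGroup V]
    [NormedSpace ℝ V] [FiniteDimensional ℝ V] [MeasurableSpace V] [BorelSpace V] [Nonempty ι]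
    {μ : Measure V} [IsProbabilityMeasure μ] {R : ℝ≥0} (hR : 0 < R)
    (hμ : ∀ᵐ x ∂μ, x ∈ closedBall 0 (R : ℝ))
    {Z : ι → Ω → V} (hZ : ∀ i, HasLaw (Z i) μ P) (hind : Pairwise fun i j => Z i ⟂ᵢ[P] Z j) :
    ∃ D : Ω → ℝ, Integrable D P ∧
      (∀ᵐ ω ∂P, LipschitzDiscrepancyLE μ (empiricalMeasure fun i => Z i ω) (D ω)) ∧
      ∫ ω, D ω ∂P ≤ R * (2 + 3 ^ Module.finrank ℝ V) *
        (Fintype.card ι : ℝ) ^ (-(1 / ((Module.finrank ℝ V : ℝ) + 2))) := by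
  set k := Module.finrank ℝ V
  set N : ℝ≥0 := (Fintype.card ι : ℝ≥0)
  have hN : 1 ≤ N := Nat.one_le_cast.2 Fintype.card_pos
  set a : ℝ≥0 := N ^ (-(1 / ((k : ℝ) + 2)))
  have ha : 0 < a := NNReal.rpow_pos (one_pos.trans_le hN)
  have ha1 : a ≤ 1 := NNReal.rpow_le_one_of_one_le_of_nonpos hN
    (neg_nonpos.2 (by positivity))
  have haN : a ^ (k + 2) = N⁻¹ := by
    rw [← NNReal.rpow_natCast, ← NNReal.rpow_mul, ← NNReal.rpow_neg_one]
    congr 1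
    push_cast
    field_simp
  obtain ⟨D, hD, hle, hint⟩ :=
    exists_integrable_lipschitzDiscrepancyLE hμ hZ hind (mul_pos hR ha)
  refine ⟨D, hD, hle, hint.trans ?_⟩
  have hsqrt : √((1 + 2 * R / (R * a : ℝ≥0)) ^ k / N) ≤ (3 : ℝ) ^ k * a := by
    rw [NNReal.coe_mul]
    exact sqrt_one_add_div_pow_div_le hR ha ha1 (by exact_mod_cast haN)
  calc 2 * ((R * a : ℝ≥0) : ℝ) + R * √((1 + 2 * R / (R * a : ℝ≥0)) ^ k / N)
      ≤ 2 * (R * a) + R * (3 ^ k * a) := by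
        rw [NNReal.coe_mul] at *
        gcongr
    _ = R * (2 + 3 ^ k) * a := by ring

end Empirical

section ExtIntegral

open Filter

variable {d : ℕ} {μ : Measure (E d)} {φ ψ : E d → EReal} {w : E d → ℝ}

lemma extIntegral_mono (h : φ ≤ᵐ[μ] ψ) : extIntegral φ μ ≤ extIntegral ψ μ := by
  refine EReal.sub_le_sub (EReal.coe_ennreal_le_coe_ennreal_iff.2 (lintegral_mono_ae ?_))
    (EReal.coe_ennreal_le_coe_ennreal_iff.2 (lintegral_mono_ae ?_))
  · filter_upwards [h] with x hx using EReal.toENNReal_le_toENNReal hx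
  · filter_upwards [h] with x hx using EReal.toENNReal_le_toENNReal (EReal.neg_le_neg_iff.2 hx)

lemma extIntegral_congr_ae (h : φ =ᵐ[μ] ψ) : extIntegral φ μ = extIntegral ψ μ :=
  le_antisymm (extIntegral_mono h.le) (extIntegral_mono h.symm.le)

lemma extIntegral_coe (hw : Integrable w μ) :
    extIntegral (fun x => (w x : EReal)) μ = ((∫ x, w x ∂μ : ℝ) : EReal) := by
  have hneg : ∫⁻ x, ENNReal.ofReal (-w x) ∂μ ≠ ⊤ := hw.neg.lintegral_lt_top.ne
  rw [integral_eq_lintegral_pos_part_sub_lintegral_neg_part hw, extIntegral, EReal.coe_sub,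
    EReal.coe_ennreal_toReal hw.lintegral_lt_top.ne, EReal.coe_ennreal_toReal hneg]
  rfl

lemma extIntegral_top [NeZero μ] : extIntegral (fun _ => ⊤) μ = ⊤ := by
  simp [extIntegral, NeZero.ne μ]

lemma coe_integral_le_extIntegral (hw : Integrable w μ) (h : ∀ᵐ x ∂μ, (w x : EReal) ≤ φ x) :
    ((∫ x, w x ∂μ : ℝ) : EReal) ≤ extIntegral φ μ :=
  extIntegral_coe hw ▸ extIntegral_mono h

lemma integrable_toReal_of_extIntegral_ne_top (hφ : Measurable φ) (hw : Integrable w μ)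
    (h : ∀ᵐ x ∂μ, (w x : EReal) ≤ φ x) (htop : extIntegral φ μ ≠ ⊤) :
    (∀ᵐ x ∂μ, ((φ x).toReal : EReal) = φ x) ∧ Integrable (fun x => (φ x).toReal) μ := by
  have hneg : ∫⁻ x, (-φ x).toENNReal ∂μ ≠ ⊤ := by
    refine ne_top_of_le_ne_top hw.neg.lintegral_lt_top.ne (lintegral_mono_ae ?_)
    filter_upwards [h] with x hx
    exact EReal.toENNReal_le_toENNReal (EReal.neg_le_neg_iff.2 hx)
  have hpos : ∫⁻ x, (φ x).toENNReal ∂μ ≠ ⊤ := by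
    contrapose! htop
    rw [extIntegral, htop, ← EReal.coe_ennreal_toReal hneg, EReal.coe_ennreal_top,
      EReal.top_sub_coe]
  have hcoe : ∀ᵐ x ∂μ, ((φ x).toReal : EReal) = φ x := by
    filter_upwards [h, ae_lt_top (measurable_ereal_toENNReal.comp hφ) hpos] with x hx hx'
    exact EReal.coe_toReal (EReal.toENNReal_ne_top_iff.1 hx'.ne)
      ((EReal.bot_lt_coe _).trans_le hx).ne'
  refine ⟨hcoe, ((integrable_toReal_of_lintegral_ne_top
    (measurable_ereal_toENNReal.comp hφ).aemeasurable hpos).sub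
    (integrable_toReal_of_lintegral_ne_top
    (measurable_ereal_toENNReal.comp hφ.neg).aemeasurable hneg)).congr ?_⟩
  filter_upwards [hcoe] with x hx
  simp only [Pi.sub_apply, Function.comp_apply, Pi.neg_apply]
  rw [← hx, ← EReal.coe_neg, EReal.real_coe_toENNReal, EReal.real_coe_toENNReal, EReal.toReal_coe,
    ENNReal.toReal_ofReal', ENNReal.toReal_ofReal', max_zero_sub_max_neg_zero_eq_self]

lemma ae_eq_coe_of_extIntegral_le (hφ : Measurable φ) (hw : Integrable w μ)
    (h : ∀ᵐ x ∂μ, (w x : EReal) ≤ φ x) (hint : extIntegral φ μ ≤ ((∫ x, w x ∂μ : ℝ) : EReal)) :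
    ∀ᵐ x ∂μ, φ x = w x := by
  obtain ⟨hcoe, hφint⟩ := integrable_toReal_of_extIntegral_ne_top hφ hw h
    (hint.trans_lt (EReal.coe_lt_top _)).ne
  have hle : w ≤ᵐ[μ] fun x => (φ x).toReal := by
    filter_upwards [h, hcoe] with x hx hx'
    rwa [← hx', EReal.coe_le_coe_iff] at hx
  rw [← extIntegral_congr_ae hcoe, extIntegral_coe hφint, EReal.coe_le_coe_iff] at hint
  have heq := (integral_eq_iff_of_ae_le hw hφint hle).1
    (le_antisymm (integral_mono_ae hw hφint hle) hint)
  filter_upwards [hcoe, heq] with x hx hx'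
  rw [← hx, hx']

end ExtIntegral

section ConvexDifferentiability

variable {F : Type*} [NormedAddCommGroup F] [NormedSpace ℝ F] [FiniteDimensional ℝ F]
  [MeasurableSpace F] [BorelSpace F] {m : Measure F} [m.IsAddHaarMeasure] {s : Set F} {w : F → ℝ}

lemma ae_differentiableAt_of_locallyLipschitzOn (hs : IsOpen s) (hw : LocallyLipschitzOn s w) :
    ∀ᵐ x ∂m, x ∈ s → DifferentiableAt ℝ w x := by
  have hloc : ∀ x ∈ s, ∃ K, ∃ t : Set F, IsOpen t ∧ x ∈ t ∧ LipschitzOnWith K w t := by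
    intro x hx
    obtain ⟨K, t, ht, hK⟩ := hw hx
    rw [hs.nhdsWithin_eq hx] at ht
    obtain ⟨t', htt', ht', hxt'⟩ := _root_.mem_nhds_iff.1 ht
    exact ⟨K, t', ht', hxt', hK.mono htt'⟩
  choose! K t ht hxt hK using hloc
  obtain ⟨T, hTs, hTcountable, hTcover⟩ := TopologicalSpace.countable_cover_nhdsWithin
    fun x hx => mem_nhdsWithin_of_mem_nhds ((ht x hx).mem_nhds (hxt x hx))
  have hall : ∀ᵐ x ∂m, ∀ y ∈ T, x ∈ t y → DifferentiableWithinAt ℝ w (t y) x :=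
    (ae_ball_iff hTcountable).2 fun y hy => (hK y (hTs hy)).ae_differentiableWithinAt_of_mem
  filter_upwards [hall] with x hx hxs
  obtain ⟨y, hyT, hxy⟩ := mem_iUnion₂.1 (hTcover hxs)
  exact (hx y hyT hxy).differentiableAt ((ht y (hTs hyT)).mem_nhds hxy)

lemma ae_mem_interior_and_differentiableAt_of_convexOn (hw : ConvexOn ℝ s w) :
    ∀ᵐ x ∂m, x ∈ s → x ∈ interior s ∧ DifferentiableAt ℝ w x := by
  have hfrontier : ∀ᵐ x ∂m, x ∉ frontier s :=
    measure_eq_zero_iff_ae_notMem.1 (hw.1.addHaar_frontier m)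
  filter_upwards [hfrontier,
    ae_differentiableAt_of_locallyLipschitzOn isOpen_interior hw.locallyLipschitzOn_interior]
    with x hx hdiff hxs
  have hxi : x ∈ interior s := by
    by_contra hcon
    exact hx ⟨subset_closure hxs, hcon⟩
  exact ⟨hxi, hdiff hxi⟩

end ConvexDifferentiability

section GammaZero

variable {d : ℕ} {φ : E d → EReal} {w : E d → ℝ} {R r : ℝ≥0}

lemma isGammaZero_coe (hw : ConvexOn ℝ univ w) (hc : Continuous w) :
    IsGammaZero fun x => (w x : EReal) where
  convex_epigraph := by
    simpa only [mem_univ, true_and, EReal.coe_le_coe_iff] using hw.convex_epigraph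
  lowerSemicontinuous := (continuous_coe_real_ereal.comp hc).lowerSemicontinuous
  ne_bot x := EReal.coe_ne_bot _
  proper := ⟨0, EReal.coe_ne_top _⟩

lemma IsGammaZero.coe_toReal (hφ : IsGammaZero φ) {x : E d} (hx : φ x ≠ ⊤) :
    ((φ x).toReal : EReal) = φ x :=
  EReal.coe_toReal hx (hφ.ne_bot x)

lemma IsGammaZero.convexOn_toReal (hφ : IsGammaZero φ) :
    ConvexOn ℝ {x | φ x ≠ ⊤} fun x => (φ x).toReal := by
  have hcombo : ∀ x, φ x ≠ ⊤ → ∀ z, φ z ≠ ⊤ → ∀ α β : ℝ, 0 ≤ α → 0 ≤ β → α + β = 1 →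
      φ (α • x + β • z) ≤ ((α * (φ x).toReal + β * (φ z).toReal : ℝ) : EReal) :=
    fun x hx z hz α β hα hβ hαβ => hφ.convex_epigraph (x := (x, (φ x).toReal))
      (y := (z, (φ z).toReal)) (hφ.coe_toReal hx).ge (hφ.coe_toReal hz).ge hα hβ hαβ
  have hconvex : Convex ℝ {x | φ x ≠ ⊤} := fun x hx z hz α β hα hβ hαβ =>
    ((hcombo x hx z hz α β hα hβ hαβ).trans_lt (EReal.coe_lt_top _)).ne
  refine ⟨hconvex, fun x hx z hz α β hα hβ hαβ => ?_⟩
  have h := hcombo x hx z hz α β hα hβ hαβ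
  rwa [← hφ.coe_toReal (hconvex hx hz hα hβ hαβ), EReal.coe_le_coe_iff] at h

lemma IsGammaZero.bddBelow_image_toReal (hφ : IsGammaZero φ) (c : ℝ) :
    BddBelow ((fun x => (φ x).toReal) '' (closedBall 0 c ∩ {x | φ x ≠ ⊤})) := by
  rcases (closedBall (0 : E d) c).eq_empty_or_nonempty with hempty | hne
  · simp [hempty]
  obtain ⟨x, _, hx⟩ := LowerSemicontinuousOn.exists_isMinOn hne (isCompact_closedBall 0 c)
    (hφ.lowerSemicontinuous.lowerSemicontinuousOn _)
  obtain ⟨b, -, hb⟩ := EReal.lt_iff_exists_real_btwn.1 (bot_lt_iff_ne_bot.2 (hφ.ne_bot x))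
  refine ⟨b, ?_⟩
  rintro _ ⟨z, hz, rfl⟩
  rw [← EReal.coe_le_coe_iff, hφ.coe_toReal hz.2]
  exact hb.le.trans (hx hz.1)

/-- The Legendre transform of `φ` with the supremum restricted to the part of the domain of `φ` in
the ball of radius `r`. Unlike `conjugate φ` it is real-valued and Lipschitz. -/
def truncatedConjugate (φ : E d → EReal) (r : ℝ≥0) : E d → ℝ :=
  conjugateOn (closedBall 0 (r : ℝ) ∩ {x | φ x ≠ ⊤}) fun x => (φ x).toReal

lemma IsGammaZero.lipschitzWith_truncatedConjugate (hφ : IsGammaZero φ)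
    (hne : (closedBall 0 (r : ℝ) ∩ {x | φ x ≠ ⊤}).Nonempty) :
    LipschitzWith r (truncatedConjugate φ r) :=
  lipschitzWith_conjugateOn hne inter_subset_left (hφ.bddBelow_image_toReal r)

lemma IsGammaZero.inner_sub_le_conjugate (hφ : IsGammaZero φ) {x : E d} (hx : φ x ≠ ⊤) (y : E d) :
    ((⟪x, y⟫ - (φ x).toReal : ℝ) : EReal) ≤ conjugate φ y := by
  rw [EReal.coe_sub, hφ.coe_toReal hx]
  exact le_iSup (fun x => ((⟪x, y⟫ : ℝ) : EReal) - φ x) x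

lemma IsGammaZero.truncatedConjugate_le_conjugate (hφ : IsGammaZero φ)
    (hne : (closedBall 0 (r : ℝ) ∩ {x | φ x ≠ ⊤}).Nonempty) (y : E d) :
    (truncatedConjugate φ r y : EReal) ≤ conjugate φ y := by
  refine EReal.le_of_forall_lt_iff_le.1 fun c hc => ?_
  rw [EReal.coe_le_coe_iff]
  refine conjugateOn_le hne fun x hx => ?_
  rw [← EReal.coe_le_coe_iff]
  exact (hφ.inner_sub_le_conjugate hx.2 y).trans hc.le

lemma IsGammaZero.conjugateOn_truncatedConjugate_le (hφ : IsGammaZero φ) {x : E d}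
    (hx : x ∈ closedBall 0 (r : ℝ)) :
    (conjugateOn (closedBall 0 (R : ℝ)) (truncatedConjugate φ r) x : EReal) ≤ φ x := by
  by_cases hxt : φ x = ⊤
  · simp only [hxt, le_top]
  rw [← hφ.coe_toReal hxt, EReal.coe_le_coe_iff]
  refine conjugateOn_le (nonempty_closedBall.2 R.2) fun y _ => ?_
  have h := inner_sub_le_conjugateOn inter_subset_left (hφ.bddBelow_image_toReal r) ⟨hx, hxt⟩ y
  rw [real_inner_comm]
  exact sub_le_comm.1 h

lemma conjugate_coe_conjugateOn_le (hw : Continuous w) {y : E d} (hy : y ∈ closedBall 0 (R : ℝ)) :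
    conjugate (fun x => (conjugateOn (closedBall 0 (R : ℝ)) w x : EReal)) y ≤ w y := by
  refine iSup_le fun x => ?_
  rw [← EReal.coe_sub, EReal.coe_le_coe_iff, real_inner_comm]
  exact sub_le_iff_le_add'.2
    (inner_le_conjugateOn_closedBall_add hw (mem_closedBall_zero_iff.1 hy) x)

lemma IsGammaZero.ae_isSubgradientAt_extGradient (hφ : IsGammaZero φ) {μ : Measure (E d)}
    (hac : μ ≪ volume) (heq : ∀ᵐ x ∂μ, φ x = w x)
    (hle : ∀ᵐ x ∂μ, ∀ᶠ z in nhds x, (w z : EReal) ≤ φ z)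
    (hw : ∀ x, ∃ p, IsSubgradientAt w p x) :
    ∀ᵐ x ∂μ, IsSubgradientAt w (extGradient φ x) x := by
  filter_upwards [heq, hle,
    hac.ae_le (ae_mem_interior_and_differentiableAt_of_convexOn hφ.convexOn_toReal)]
    with x hx hxle hxdiff
  obtain ⟨hxi, hdiff⟩ := hxdiff (hx ▸ EReal.coe_ne_top _)
  obtain ⟨p, hp⟩ := hw x
  have hnear : ∀ᶠ z in nhds x, w z ≤ (φ z).toReal := by
    filter_upwards [hxle, isOpen_interior.mem_nhds hxi] with z hz hzi
    rwa [← hφ.coe_toReal (interior_subset hzi), EReal.coe_le_coe_iff] at hz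
  have hgrad : extGradient φ x = p := hp.gradient_eq hnear (hx ▸ EReal.toReal_coe _) hdiff
  rwa [hgrad]

end GammaZero

section BrenierPotential

variable {d : ℕ} {μ ν : Measure (E d)} {φ : E d → EReal} {R : ℝ≥0}

lemma HasDensityAtMost.le_smul_volume {M : ℝ≥0} (h : HasDensityAtMost μ M) :
    μ ≤ M • (volume : Measure (E d)) := by
  obtain ⟨ρ, -, rfl, hρ⟩ := h
  calc (volume : Measure (E d)).withDensity ρ
      ≤ (volume : Measure (E d)).withDensity fun _ => ENNReal.ofReal M := withDensity_mono hρ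
    _ = M • volume := by rw [withDensity_const, ENNReal.ofReal_coe_nnreal]; rfl

variable [IsFiniteMeasure μ] [IsFiniteMeasure ν]

lemma IsBrenierPotential.dualObjective_le_semidual (hφ : IsBrenierPotential μ ν φ)
    (hμ : ∀ᵐ x ∂μ, x ∈ closedBall 0 (R : ℝ)) (hν : ∀ᵐ y ∂ν, y ∈ closedBall 0 (R : ℝ))
    {w : E d → ℝ} (hw : Continuous w) : dualObjective μ ν φ ≤ (semidual μ ν R w : EReal) := by
  have hcont := (lipschitzWith_conjugateOn_closedBall (r := R) hw).continuous
  refine (hφ.optimal _ (isGammaZero_coe (convexOn_conjugateOn_closedBall hw) hcont)).trans ?_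
  rw [dualObjective, semidual, EReal.coe_add, extIntegral_coe (integrable_of_continuous hμ hcont),
    ← extIntegral_coe (integrable_of_continuous hν hw)]
  gcongr
  exact extIntegral_mono (hν.mono fun y hy => conjugate_coe_conjugateOn_le hw hy)

lemma IsGammaZero.extIntegral_conjugate_ne_bot (hφ : IsGammaZero φ)
    (hν : ∀ᵐ y ∂ν, y ∈ closedBall 0 (R : ℝ)) : extIntegral (conjugate φ) ν ≠ ⊥ := by
  obtain ⟨x, hx⟩ := hφ.proper
  have hcont : Continuous fun y => ⟪x, y⟫ - (φ x).toReal := by fun_prop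
  exact ((EReal.bot_lt_coe _).trans_le (coe_integral_le_extIntegral
    (integrable_of_continuous hν hcont) (.of_forall (hφ.inner_sub_le_conjugate hx)))).ne'

lemma IsBrenierPotential.nonempty_closedBall_inter_ne_top [NeZero μ]
    (hφ : IsBrenierPotential μ ν φ) (hμ : ∀ᵐ x ∂μ, x ∈ closedBall 0 (R : ℝ))
    (hν : ∀ᵐ y ∂ν, y ∈ closedBall 0 (R : ℝ)) :
    (closedBall 0 (R : ℝ) ∩ {x | φ x ≠ ⊤}).Nonempty := by
  by_contra hempty
  have htop : φ =ᵐ[μ] fun _ => ⊤ := by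
    filter_upwards [hμ] with x hx
    by_contra hxt
    exact hempty ⟨x, hx, hxt⟩
  have hle := hφ.dualObjective_le_semidual hμ hν (w := fun _ => 0) continuous_const
  rw [dualObjective, extIntegral_congr_ae htop, extIntegral_top,
    EReal.top_add_of_ne_bot (hφ.gammaZero.extIntegral_conjugate_ne_bot hν)] at hle
  exact hle.not_gt (EReal.coe_lt_top _)

/-- Truncating at radius `2 * R` rather than `R` leaves room for a neighbourhood of the support of
`μ`, on which `φ` has to be compared with the double transform to identify its gradient. -/
theorem IsBrenierPotential.exists_semidual_minimizer [NeZero μ] (hφ : IsBrenierPotential μ ν φ)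
    (hR : 0 < (R : ℝ)) (hμ : ∀ᵐ x ∂μ, x ∈ closedBall 0 (R : ℝ))
    (hν : ∀ᵐ y ∂ν, y ∈ closedBall 0 (R : ℝ)) (hac : μ ≪ volume) :
    ∃ a : E d → ℝ, LipschitzWith (2 * R) a ∧
      (∀ w, Continuous w → semidual μ ν R a ≤ semidual μ ν R w) ∧
      ∀ᵐ x ∂μ, IsSubgradientAt (conjugateOn (closedBall 0 (R : ℝ)) a) (extGradient φ x) x := by
  have hΓ := hφ.gammaZero
  have hball : closedBall (0 : E d) R ⊆ ball 0 (2 * R : ℝ≥0) :=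
    closedBall_subset_ball (by push_cast; linarith)
  have hne : (closedBall 0 ((2 * R : ℝ≥0) : ℝ) ∩ {x | φ x ≠ ⊤}).Nonempty :=
    (hφ.nonempty_closedBall_inter_ne_top hμ hν).mono
      (inter_subset_inter_left _ (hball.trans ball_subset_closedBall))
  set a := truncatedConjugate φ (2 * R)
  set u := conjugateOn (closedBall 0 (R : ℝ)) a
  have ha : LipschitzWith (2 * R) a := hΓ.lipschitzWith_truncatedConjugate hne
  have hu : Continuous u := (lipschitzWith_conjugateOn_closedBall ha.continuous).continuous
  have huint : Integrable u μ := integrable_of_continuous hμ hu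
  have hunear : ∀ᵐ x ∂μ, ∀ᶠ z in nhds x, (u z : EReal) ≤ φ z := by
    filter_upwards [hμ] with x hx
    filter_upwards [isOpen_ball.mem_nhds (hball hx)] with z hz
    exact hΓ.conjugateOn_truncatedConjugate_le (ball_subset_closedBall hz)
  have hule : ∀ᵐ x ∂μ, (u x : EReal) ≤ φ x := hunear.mono fun x hx => hx.self_of_nhds
  have hconj : ((∫ y, a y ∂ν : ℝ) : EReal) ≤ extIntegral (conjugate φ) ν :=
    coe_integral_le_extIntegral (integrable_of_continuous hν ha.continuous)
      (.of_forall (hΓ.truncatedConjugate_le_conjugate hne))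
  refine ⟨a, ha, fun w hw => ?_, hΓ.ae_isSubgradientAt_extGradient hac ?_ hunear fun x =>
    exists_isSubgradientAt_conjugateOn (nonempty_closedBall.2 R.2) (isCompact_closedBall 0 _)
      ha.continuous.continuousOn x⟩
  · rw [← EReal.coe_le_coe_iff]
    refine le_trans ?_ (hφ.dualObjective_le_semidual hμ hν hw)
    rw [semidual, EReal.coe_add]
    exact add_le_add (coe_integral_le_extIntegral huint hule) hconj
  · have hle := (add_le_add_right hconj _).trans (hφ.dualObjective_le_semidual hμ hν ha.continuous)
    rw [semidual, EReal.coe_add] at hle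
    exact ae_eq_coe_of_extIntegral_le hΓ.lowerSemicontinuous.measurable huint hule
      ((EReal.addLECancellable_coe _).add_le_add_iff_right.1 hle)

end BrenierPotential

section Estimator

variable {d n m : ℕ} {x : Fin n → E d} {y : Fin m → E d} {f : Fin n → ℝ} {g : Fin m → ℝ}
  {R : ℝ≥0}

lemma affinePiece_eq_inner_sub (y : Fin m → E d) (g : Fin m → ℝ) (k : Fin m) (x : E d) :
    affinePiece y g k x = ⟪y k, x⟫ - (‖y k‖ ^ 2 / 2 - g k) := by
  rw [affinePiece, real_inner_comm]
  ring

lemma explicitPotential_eq_affineSup (y : Fin m → E d) (g : Fin m → ℝ) :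
    explicitPotential y g = affineSup y fun k => ‖y k‖ ^ 2 / 2 - g k := by
  ext x
  exact iSup_congr fun k => affinePiece_eq_inner_sub y g k x

lemma affinePiece_le_explicitPotential (y : Fin m → E d) (g : Fin m → ℝ) (k : Fin m) (x : E d) :
    affinePiece y g k x ≤ explicitPotential y g x :=
  le_ciSup (f := fun k => affinePiece y g k x) (finite_range _).bddAbove k

lemma isDualFeasible_iff_inner_le : IsDualFeasible x y f g ↔
    ∀ i j, ⟪x i, y j⟫ ≤ (‖x i‖ ^ 2 / 2 - f i) + (‖y j‖ ^ 2 / 2 - g j) := by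
  refine forall₂_congr fun i j => ?_
  rw [norm_sub_sq_real]
  constructor <;> intro h <;> linarith

lemma conjugateOn_explicitPotential_le {S : Set (E d)} (hS : S.Nonempty) (y : Fin m → E d)
    (g : Fin m → ℝ) (j : Fin m) :
    conjugateOn S (explicitPotential y g) (y j) ≤ ‖y j‖ ^ 2 / 2 - g j := by
  refine conjugateOn_le hS fun z _ => ?_
  have h := affinePiece_le_explicitPotential y g j z
  rw [affinePiece] at h
  linarith

variable [NeZero m]

lemma IsDualFeasible.explicitPotential_le (h : IsDualFeasible x y f g) (i : Fin n) :
    explicitPotential y g (x i) ≤ ‖x i‖ ^ 2 / 2 - f i := by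
  refine ciSup_le fun j => ?_
  have hij := isDualFeasible_iff_inner_le.1 h i j
  rw [affinePiece]
  linarith

lemma lipschitzWith_explicitPotential (hy : ∀ j, ‖y j‖ ≤ R) (g : Fin m → ℝ) :
    LipschitzWith R (explicitPotential y g) :=
  explicitPotential_eq_affineSup y g ▸ lipschitzWith_affineSup hy (finite_range _).bddBelow

lemma convexOn_explicitPotential (hy : ∀ j, ‖y j‖ ≤ R) (g : Fin m → ℝ) :
    ConvexOn ℝ univ (explicitPotential y g) :=
  explicitPotential_eq_affineSup y g ▸ convexOn_affineSup hy (finite_range _).bddBelow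

lemma isSubgradientAt_mongeEstimator (hy : ∀ j, ‖y j‖ ≤ R) (g : Fin m → ℝ) (z : E d) :
    IsSubgradientAt (explicitPotential y g) (mongeEstimator y g z) z := by
  have hactive : (activeSet y g z).Nonempty := by
    obtain ⟨j, hj⟩ := exists_eq_ciSup_of_finite (f := fun j => affinePiece y g j z)
    exact ⟨j, Finset.mem_filter.2 ⟨Finset.mem_univ j, hj.symm⟩⟩
  refine IsSubgradientAt.average hactive fun j hj => ?_
  have hjz : explicitPotential y g z = affinePiece y g j z := (Finset.mem_filter.1 hj).2
  rw [affinePiece_eq_inner_sub, explicitPotential_eq_affineSup] at hjz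
  rw [explicitPotential_eq_affineSup]
  exact isSubgradientAt_affineSup hy (finite_range _).bddBelow hjz

lemma IsEmpiricalDualOptimal.integral_le_semidual (h : IsEmpiricalDualOptimal x y f g)
    (hy : ∀ j, ‖y j‖ ≤ R) {S : Set (E d)} (hS : S.Nonempty) {a : E d → ℝ} (ha : Continuous a) :
    ∫ z, explicitPotential y g z ∂empiricalMeasure x
        + ∫ z, conjugateOn S (explicitPotential y g) z ∂empiricalMeasure y
      ≤ semidual (empiricalMeasure x) (empiricalMeasure y) R a := by
  have hoptimal := h.optimal
    (fun i => ‖x i‖ ^ 2 / 2 - conjugateOn (closedBall 0 (R : ℝ)) a (x i))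
    (fun j => ‖y j‖ ^ 2 / 2 - a (y j)) <| isDualFeasible_iff_inner_le.2 fun i j => by
      rw [sub_sub_cancel, sub_sub_cancel, real_inner_comm]
      exact inner_le_conjugateOn_closedBall_add ha (hy j) (x i)
  have hx : (n : ℝ)⁻¹ * ∑ i, explicitPotential y g (x i)
      ≤ (n : ℝ)⁻¹ * ∑ i, (‖x i‖ ^ 2 / 2 - f i) := by
    gcongr with i
    exact h.feasible.explicitPotential_le i
  have hy : (m : ℝ)⁻¹ * ∑ j, conjugateOn S (explicitPotential y g) (y j)
      ≤ (m : ℝ)⁻¹ * ∑ j, (‖y j‖ ^ 2 / 2 - g j) := by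
    gcongr with j
    exact conjugateOn_explicitPotential_le hS y g j
  simp only [semidual, integral_empiricalMeasure, Fintype.card_fin]
  simp only [← Finset.sum_mul, Finset.sum_sub_distrib] at hoptimal hx hy
  linarith

end Estimator

section Convergence

lemma LipschitzDiscrepancyLE.semidual_gap_le {F : Type*} [NormedAddCommGroup F]
    [InnerProductSpace ℝ F] [ProperSpace F] [MeasurableSpace F] {μ ν μ' ν' : Measure F} {δ δ' : ℝ}
    (hμ : LipschitzDiscrepancyLE μ μ' δ) (hν : LipschitzDiscrepancyLE ν ν' δ') {R : ℝ≥0}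
    {v a : F → ℝ} (hv : LipschitzWith R v) (ha : LipschitzWith (2 * R) a)
    (hle : ∫ x, v x ∂μ' + ∫ y, conjugateOn (closedBall 0 ((2 * R : ℝ≥0) : ℝ)) v y ∂ν'
      ≤ semidual μ' ν' R a) :
    ∫ x, v x ∂μ + ∫ y, conjugateOn (closedBall 0 ((2 * R : ℝ≥0) : ℝ)) v y ∂ν - semidual μ ν R a
      ≤ 4 * R * (δ + δ') := by
  have hv_gap := abs_le.1 (hμ hv)
  have hv_conj := abs_le.1 (hν (lipschitzWith_conjugateOn_closedBall (r := 2 * R) hv.continuous))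
  have ha_conj := abs_le.1 (hμ (lipschitzWith_conjugateOn_closedBall (r := R) ha.continuous))
  have ha_gap := abs_le.1 (hν ha)
  have hδ : 0 ≤ R * δ := mul_nonneg R.2 hμ.nonneg
  rw [semidual] at *
  push_cast at *
  linarith [hv_gap.2, hv_conj.2, ha_conj.1, ha_gap.1]

variable {d n m : ℕ} {R M : ℝ≥0} {μ ν : Measure (E d)} [IsProbabilityMeasure μ]
  [IsProbabilityMeasure ν] {φ : E d → EReal}

theorem IsBrenierPotential.lintegral_enorm_sub_mongeEstimator_le [NeZero m]
    (hφ : IsBrenierPotential μ ν φ) (hR : 0 < R) (hμ : ∀ᵐ x ∂μ, x ∈ closedBall 0 (R : ℝ))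
    (hν : ∀ᵐ y ∂ν, y ∈ closedBall 0 (R : ℝ)) (hden : HasDensityAtMost μ M)
    {x : Fin n → E d} {y : Fin m → E d} (hy : ∀ j, ‖y j‖ ≤ R) {f : Fin n → ℝ} {g : Fin m → ℝ}
    (hfg : IsEmpiricalDualOptimal x y f g) {δ δ' : ℝ}
    (hx_disc : LipschitzDiscrepancyLE μ (empiricalMeasure x) δ)
    (hy_disc : LipschitzDiscrepancyLE ν (empiricalMeasure y) δ') {t : ℝ} (ht : 0 < t)
    (htR : t ≤ R) :
    ∫⁻ z, ‖extGradient φ z - mongeEstimator y g z‖ₑ ∂μ ≤ ENNReal.ofReal (d * (t⁻¹ *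
      (4 * R * (δ + δ')) + 2 * M * (volume : Measure (E d)).real (closedBall 0 (3 * R)) * t)) := by
  have hden' := hden.le_smul_volume
  obtain ⟨a, ha, hmin, hsub⟩ := hφ.exists_semidual_minimizer (NNReal.coe_pos.2 hR) hμ hν
    (Measure.absolutelyContinuous_of_le_smul hden')
  have hv := lipschitzWith_explicitPotential hy g
  have hgap := hx_disc.semidual_gap_le hy_disc hv ha
    (hfg.integral_le_semidual hy (nonempty_closedBall.2 (2 * R).2) ha.continuous)
  refine (lintegral_enorm_sub_le (NNReal.coe_pos.2 hR) hμ hν hden' ha.continuous hmin hv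
    (convexOn_explicitPotential hy g) hsub (.of_forall (isSubgradientAt_mongeEstimator hy g)) ht
    htR).trans (ENNReal.ofReal_le_ofReal ?_)
  rw [finrank_euclideanSpace_fin]
  gcongr

theorem IsBrenierPotential.lintegral_lintegral_enorm_sub_mongeEstimator_le [NeZero n] [NeZero m]
    (hφ : IsBrenierPotential μ ν φ) (hR : 0 < R) (hμ : ∀ᵐ x ∂μ, x ∈ closedBall 0 (R : ℝ))
    (hν : ∀ᵐ y ∂ν, y ∈ closedBall 0 (R : ℝ)) (hden : HasDensityAtMost μ M)
    {Ω : Type*} [MeasurableSpace Ω] {P : Measure Ω} [IsProbabilityMeasure P]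
    {X : Fin n → Ω → E d} {Y : Fin m → Ω → E d} (hX : ∀ i, HasLaw (X i) μ P)
    (hX_ind : Pairwise fun i j => X i ⟂ᵢ[P] X j) (hY : ∀ j, HasLaw (Y j) ν P)
    (hY_ind : Pairwise fun i j => Y i ⟂ᵢ[P] Y j) {f : Ω → Fin n → ℝ} {g : Ω → Fin m → ℝ}
    (hfg : ∀ᵐ ω ∂P, IsEmpiricalDualOptimal (fun i => X i ω) (fun j => Y j ω) (f ω) (g ω))
    {t : ℝ} (ht : 0 < t) (htR : t ≤ R) :
    ∫⁻ ω, ∫⁻ x, ‖extGradient φ x - mongeEstimator (fun j => Y j ω) (g ω) x‖ₑ ∂μ ∂P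
      ≤ ENNReal.ofReal (d * (t⁻¹ * (4 * R * (R * (2 + 3 ^ d) *
          ((n : ℝ) ^ (-(1 / ((d : ℝ) + 2))) + (m : ℝ) ^ (-(1 / ((d : ℝ) + 2))))))
        + 2 * M * (volume : Measure (E d)).real (closedBall 0 (3 * R)) * t)) := by
  obtain ⟨D, hD, hD_disc, hD_le⟩ := exists_integrable_lipschitzDiscrepancyLE_rate hR hμ hX hX_ind
  obtain ⟨D', hD', hD'_disc, hD'_le⟩ :=
    exists_integrable_lipschitzDiscrepancyLE_rate hR hν hY hY_ind
  have hY_ball : ∀ᵐ ω ∂P, ∀ j, ‖Y j ω‖ ≤ R := ae_all_iff.2 fun j =>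
    (((hY j).ae_iff measurableSet_closedBall.mem).2 hν).mono fun ω => mem_closedBall_zero_iff.1
  set V := (volume : Measure (E d)).real (closedBall 0 (3 * R))
  have hsum : Integrable (fun ω => t⁻¹ * (4 * R * (D ω + D' ω))) P :=
    ((hD.add hD').const_mul _).const_mul _
  have hbound : Integrable (fun ω => d * (t⁻¹ * (4 * R * (D ω + D' ω)) + 2 * M * V * t)) P :=
    (hsum.add (integrable_const _)).const_mul _
  calc ∫⁻ ω, ∫⁻ x, ‖extGradient φ x - mongeEstimator (fun j => Y j ω) (g ω) x‖ₑ ∂μ ∂P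
      ≤ ∫⁻ ω, ENNReal.ofReal (d * (t⁻¹ * (4 * R * (D ω + D' ω)) + 2 * M * V * t)) ∂P := by
        refine lintegral_mono_ae ?_
        filter_upwards [hfg, hD_disc, hD'_disc, hY_ball] with ω hω hDω hD'ω hYω
        exact hφ.lintegral_enorm_sub_mongeEstimator_le hR hμ hν hden hYω hω hDω hD'ω ht htR
    _ = ENNReal.ofReal (∫ ω, d * (t⁻¹ * (4 * R * (D ω + D' ω)) + 2 * M * V * t) ∂P) := by
        refine (ofReal_integral_eq_lintegral_ofReal hbound ?_).symm
        filter_upwards [hD_disc, hD'_disc] with ω hDω hD'ω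
        have := hDω.nonneg
        have := hD'ω.nonneg
        simp only [Pi.zero_apply]
        positivity
    _ ≤ _ := by
        rw [Fintype.card_fin, finrank_euclideanSpace_fin] at hD_le hD'_le
        rw [integral_const_mul, integral_add hsum (integrable_const _), integral_const_mul,
          integral_const_mul, integral_add hD hD', integral_const, probReal_univ, one_smul,
          mul_add (R * (2 + 3 ^ d) : ℝ)]
        gcongr

lemma natCast_rpow_neg_le_two_mul_sqrt {k : ℕ} (hk : 0 < k) {e s B : ℝ} (he : e ≤ 2 * s)
    (hB : (k : ℝ) ^ (-e) ≤ 4 * B) : (k : ℝ) ^ (-s) ≤ 2 * √B := by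
  have hk1 : (1 : ℝ) ≤ k := Nat.one_le_cast.2 hk
  have hsq : ((k : ℝ) ^ (-s)) ^ 2 ≤ 4 * B := by
    rw [← Real.rpow_mul_natCast (by positivity)]
    refine (Real.rpow_le_rpow_of_exponent_le hk1 ?_).trans hB
    push_cast
    linarith
  calc (k : ℝ) ^ (-s) ≤ √(2 ^ 2 * B) := Real.le_sqrt_of_sq_le (hsq.trans_eq (by norm_num))
    _ = 2 * √B := by rw [Real.sqrt_mul (by norm_num), Real.sqrt_sq zero_le_two]

lemma sqrt_rpow_neg_add_rpow_neg_le (hn : 0 < n) (hm : 0 < m) {e s B : ℝ} (he : e ≤ 2 * s)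
    (hBn : (n : ℝ) ^ (-e) ≤ 4 * B) (hBm : (m : ℝ) ^ (-e) ≤ 4 * B) :
    √((n : ℝ) ^ (-s) + (m : ℝ) ^ (-s)) ≤ 2 * B ^ (1 / 4 : ℝ) := by
  have hB : 0 ≤ B := by linarith [Real.rpow_nonneg n.cast_nonneg (-e)]
  have hquarter : B ^ (1 / 4 : ℝ) = √(√B) := by
    rw [Real.sqrt_eq_rpow, Real.sqrt_eq_rpow, ← Real.rpow_mul hB]
    norm_num
  rw [hquarter]
  refine Real.sqrt_le_iff.2 ⟨by positivity, ?_⟩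
  rw [mul_pow, Real.sq_sqrt (Real.sqrt_nonneg B)]
  linarith [natCast_rpow_neg_le_two_mul_sqrt hn he hBn, natCast_rpow_neg_le_two_mul_sqrt hm he hBm]

lemma half_le_log_one_add {k : ℕ} (hk : 0 < k) : 1 / 2 ≤ Real.log (1 + k) := by
  have hk1 : (1 : ℝ) ≤ k := Nat.one_le_cast.2 hk
  linarith [Real.log_two_gt_d9, Real.log_le_log two_pos (by linarith : (2 : ℝ) ≤ 1 + k)]

lemma sqrt_rpow_neg_add_rpow_neg_le_rate (hd : 0 < d) (hn : 0 < n) (hm : 0 < m) :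
    √((n : ℝ) ^ (-(1 / ((d : ℝ) + 2))) + (m : ℝ) ^ (-(1 / ((d : ℝ) + 2)))) ≤ 2 * rate d n m := by
  have hpow (k : ℕ) (e : ℝ) : 0 ≤ (k : ℝ) ^ e := by positivity
  unfold rate
  split_ifs with hd1 hd2
  · refine sqrt_rpow_neg_add_rpow_neg_le hn hm (e := 1 / 2) (by norm_num [hd1]) ?_ ?_ <;>
      linarith [hpow n (-(1 / 2)), hpow m (-(1 / 2))]
  · have hlog_n := mul_le_mul_of_nonneg_left (half_le_log_one_add hn) (hpow n (-(1 / 2)))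
    have hlog_m := mul_le_mul_of_nonneg_left (half_le_log_one_add hm) (hpow m (-(1 / 2)))
    refine sqrt_rpow_neg_add_rpow_neg_le hn hm (e := 1 / 2) (by norm_num [hd2]) ?_ ?_ <;>
      linarith [hpow n (-(1 / 2)), hpow m (-(1 / 2))]
  · have hd3 : (2 : ℝ) ≤ d := by exact_mod_cast (by omega : 2 ≤ d)
    have he : 1 / (d : ℝ) ≤ 2 * (1 / ((d : ℝ) + 2)) := by
      rw [mul_one_div, div_le_div_iff₀ (by positivity) (by positivity)]
      linarith
    refine sqrt_rpow_neg_add_rpow_neg_le hn hm he ?_ ?_ <;>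
      linarith [hpow n (-(1 / d)), hpow m (-(1 / d))]

lemma inv_mul_add_mul_eq_mul_sqrt {R C V M S D : ℝ} (hR : 0 < R) (hS : 0 < S) :
    D * ((R * √S / 2)⁻¹ * (4 * R * (C * S)) + 2 * M * V * (R * √S / 2))
      = D * (8 * C + M * V * R) * √S := by
  calc D * ((R * √S / 2)⁻¹ * (4 * R * (C * S)) + 2 * M * V * (R * √S / 2))
      = D * (8 * C * (S / √S) + M * V * R * √S) := by
        field_simp [(Real.sqrt_pos.2 hS).ne']
        ring
    _ = D * (8 * C + M * V * R) * √S := by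
        rw [Real.div_sqrt]
        ring

end Convergence

end BrenierEstimation

end

open BrenierEstimation NNReal in
theorem mainTheorem1_general (d : ℕ) (R M : ℝ≥0) (hR : 0 < R) :
    ∃ C : ℝ, 0 < C ∧
      ∀ (μ ν : Measure (E d)) [IsProbabilityMeasure μ] [IsProbabilityMeasure ν],
        μ.support ⊆ Metric.closedBall 0 R → ν.support ⊆ Metric.closedBall 0 R →
        HasDensityAtMost μ M →
      ∀ φbar : E d → EReal, IsBrenierPotential μ ν φbar →
      ∀ (n m : ℕ), 0 < n → 0 < m →
      ∀ {Ω : Type*} [MeasurableSpace Ω] (P : Measure Ω) [IsProbabilityMeasure P]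
        (X : Fin n → Ω → E d) (Y : Fin m → Ω → E d),
        (∀ i, HasLaw (X i) μ P) → (Pairwise fun i j => X i ⟂ᵢ[P] X j) →
        (∀ j, HasLaw (Y j) ν P) → (Pairwise fun i j => Y i ⟂ᵢ[P] Y j) →
      ∀ (f : Ω → Fin n → ℝ) (g : Ω → Fin m → ℝ),
        (∀ᵐ ω ∂P, IsEmpiricalDualOptimal (fun i => X i ω) (fun j => Y j ω) (f ω) (g ω)) →
        ∫⁻ ω, ∫⁻ x, ‖extGradient φbar x - mongeEstimator (fun j => Y j ω) (g ω) x‖ₑ ∂μ ∂P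
          ≤ ENNReal.ofReal
            (C * √((n : ℝ) ^ (-(1 / ((d : ℝ) + 2))) + (m : ℝ) ^ (-(1 / ((d : ℝ) + 2))))) := by
  set V := (volume : Measure (E d)).real (Metric.closedBall 0 (3 * R))
  set C₀ : ℝ := R * (2 + 3 ^ d)
  refine ⟨d * (8 * C₀ + M * V * R) + 1, by positivity, ?_⟩
  intro μ ν _ _ hμ hν hden φ hφ n m hn hm Ω _ P _ X Y hX hX_ind hY hY_ind f g hfg
  have : NeZero n := ⟨hn.ne'⟩
  have : NeZero m := ⟨hm.ne'⟩
  set S := (n : ℝ) ^ (-(1 / ((d : ℝ) + 2))) + (m : ℝ) ^ (-(1 / ((d : ℝ) + 2)))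
  have hS : 0 < S := by positivity
  have hle_one (k : ℕ) (hk : 0 < k) : (k : ℝ) ^ (-(1 / ((d : ℝ) + 2))) ≤ 1 :=
    Real.rpow_le_one_of_one_le_of_nonpos (Nat.one_le_cast.2 hk) (neg_nonpos.2 (by positivity))
  have hsqrt_le : √S ≤ 2 :=
    Real.sqrt_le_iff.2 ⟨zero_le_two, by linarith [hle_one n hn, hle_one m hm]⟩
  have hbound := hφ.lintegral_lintegral_enorm_sub_mongeEstimator_le hR
    (Filter.mem_of_superset Measure.support_mem_ae hμ)
    (Filter.mem_of_superset Measure.support_mem_ae hν) hden hX hX_ind hY hY_ind hfg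
    (t := R * √S / 2) (by positivity) (by nlinarith [R.2])
  refine hbound.trans (ENNReal.ofReal_le_ofReal ?_)
  rw [inv_mul_add_mul_eq_mul_sqrt (NNReal.coe_pos.2 hR) hS, add_mul, one_mul]
  exact le_add_of_nonneg_right (Real.sqrt_nonneg S)

open BrenierEstimation in
theorem mainTheorem1 (d : ℕ) (hd : 0 < d) (R M : ℝ) (hR : 0 < R) (hM : 0 < M) :
    ∃ C : ℝ, 0 < C ∧
      ∀ (μ ν : Measure (E d)) [IsProbabilityMeasure μ] [IsProbabilityMeasure ν],
        μ.support ⊆ Metric.ball 0 R → ν.support ⊆ Metric.ball 0 R →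
        HasDensityAtMost μ M →
      ∀ φbar : E d → EReal, IsBrenierPotential μ ν φbar →
      ∀ (n m : ℕ), 0 < n → 0 < m →
      ∀ {Ω : Type*} [MeasurableSpace Ω] (P : Measure Ω) [IsProbabilityMeasure P]
        (X : Fin n → Ω → E d) (Y : Fin m → Ω → E d),
        (∀ i, HasLaw (X i) μ P) → iIndepFun X P →
        (∀ j, HasLaw (Y j) ν P) → iIndepFun Y P →
      ∀ (f : Ω → Fin n → ℝ) (g : Ω → Fin m → ℝ),
        (∀ᵐ ω ∂P, IsEmpiricalDualOptimal (fun i => X i ω) (fun j => Y j ω) (f ω) (g ω)) →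
        ∫⁻ ω, ∫⁻ x, ‖extGradient φbar x - mongeEstimator (fun j => Y j ω) (g ω) x‖ₑ ∂μ ∂P
          ≤ ENNReal.ofReal (C * rate d n m) := by
  obtain ⟨C, hC, hbound⟩ := mainTheorem1_general d ⟨R, hR.le⟩ ⟨M, hM.le⟩ hR
  refine ⟨C * 2, by positivity, ?_⟩
  intro μ ν _ _ hμ hν hden φ hφ n m hn hm Ω _ P _ X Y hX hX_ind hY hY_ind f g hfg
  refine (hbound μ ν (hμ.trans Metric.ball_subset_closedBall)
    (hν.trans Metric.ball_subset_closedBall) hden φ hφ n m hn hm P X Y hX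
    (fun _ _ => hX_ind.indepFun) hY (fun _ _ => hY_ind.indepFun) f g hfg).trans ?_
  rw [mul_assoc]
  gcongr
  exact sqrt_rpow_neg_add_rpow_neg_le_rate hd hn hm
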